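/- Let $c>1$, $0<2d<c-1$, $I_1=[-c-2d,-c+2d]$, $I_2=[-1,1]$, and let $a(n)>0$, $b(n)\in\mathbb R$ $(n\in\mathbb Z)$ satisfy $$\sum_{n\le 0}e^{C|n|}\big(|a(n)-d|+|b(n)+c|\big)+\sum_{n\ge 0}e^{Cn}\big(|a(n)-\tfrac12|+|b(n)|\big)<\infty$$ for some $C\ge\max\{c+2d+\sqrt{(c+2d)^2-1},\ \tfrac1{2d}(1+c+\sqrt{(1+c)^2-4d^2})\}$. Assume that the Jacobi operator $(Hy)(n)=a(n-1)y(n-1)+b(n)y(n)+a(n)y(n+1)$ on $\ell^2(\mathbb Z)$ has no eigenvalues. Let $\mathbb M$ be the two-sheeted Riemann surface of $\sqrt{(\lambda^2-1)((\lambda+c)^2-4d^2)}$, obtained by gluing two copies $\Pi_U,\Pi_L$ (the upper and the lower sheet, $p=(\lambda,\pm)$) of $(\mathbb C\cup\{\infty\})\setminus(I_1\cup I_2)$ crosswise along the bands; $p^*$ is the point over the same $\lambda$ on the other sheet, $\infty_\pm$ are the points at infinity, and $\Sigma=\Sigma_1\cup\Sigma_2$, where $\Sigma_j$ consists of the points $(\lambda\pm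 i0,+)$, $\lambda\in I_j$. For a function $f$ on $\mathbb M\setminus\Sigma$ and $p\in\Sigma$ let $f_+(p)$ and $f_-(p)$ be the limits of $f$ at $p$ from $\Pi_U$ and from $\Pi_L$. On $\Pi_U$ put $$z_2=\lambda-\sqrt{\lambda^2-1},\qquad z_1=\tfrac1{2d}\big(\lambda+c-\sqrt{(\lambda+c)^2-4d^2}\big),\qquad |z_j|<1,$$ $$\Phi_1=d(z_1^{-1}-z_1)-\xi\log z_1,\qquad \Phi_2=\tfrac12(z_2-z_2^{-1})+\xi\log z_2,\qquad \xi=\tfrac nt,$$ and $\Phi_j(p^*)=-\Phi_j(p)$ (functions without a subscript $\pm$ are evaluated on $\Sigma$ as limits from $\Pi_U$). Let $\psi_1,\psi_2$ be the Jost solutions, i.e. the solutions of $H\psi=\lambda\psi$ with $z_1^{n}\psi_1(n)\to1$ as $n\to-\infty$ and $z_2^{-n}\psi_2(n)\to1$ as $n\to+\infty$, let $W=a(n-1)\big(\psi_1(n-1)\psi_2(n)-\psi_1(n)\psi_2(n-1)\big)$ be their Wronskian, and assume that $W\ne0$ at the four points $-c\pm2d,\pm1$. Put $T_2=-\sqrt{\lambda^2-1}/W$,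 $T_1=-\sqrt{(\lambda+c)^2-4d^2}/W$, $\chi=-T_1\overline{T_2}$ on $\Sigma$, and define the reflection coefficients by $T_1\psi_2=\overline{\psi_1}+R_1\psi_1$ on $\Sigma_1$ and $T_2\psi_1=\overline{\psi_2}+R_2\psi_2$ on $\Sigma_2$. Fix $n\in\mathbb Z$, $t>0$ and $j\in\{1,2\}$; let $k$ be the other index, and set $\chi_2=\chi$, $\chi_1=\overline\chi$. Consider the Riemann--Hilbert problem of finding $m:\mathbb M\setminus\Sigma\to\mathbb C^2$ (row vectors), holomorphic on $\mathbb M\setminus\Sigma$, such that I. at every $p\in\Sigma$ the limits $m_\pm(p)$ exist and $m_+(p)=m_-(p)v_j(p)$, where $$v_j=\begin{pmatrix}0&-\overline{R_j}\,e^{-2t\Phi_j}\\ R_j\,e^{2t\Phi_j}&1\end{pmatrix}\text{ on }\Sigma_j,\qquad v_j=\begin{pmatrix}\chi_j\,e^{t(\Phi_{j,+}-\Phi_{j,-})}&e^{-t(\Phi_{j,+}+\Phi_{j,-})}\\ e^{t(\Phi_{j,+}+\Phi_{j,-})}&0\end{pmatrix}\text{ on }\Sigma_k;$$ II. $m(p^*)=m(p)\begin{pmatrix}0&1\\1&0\end{pmatrix}$;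 III. $\lim_{p\in\Pi_U,\,p\to\infty_+}m(p)=(\hat m,\tilde m)$ with $\hat m\,\tilde m=1$ and $\hat m>0$. Then the solution is unique: any two solutions of this problem coincide on $\mathbb M\setminus\Sigma$. Moreover, the vanishing problem, in which III is replaced by the condition that the first component of $m(\infty_+)$ is $0$, has only the solution $m\equiv0$. -/

import Mathlib

open Filter Topology Matrix
open scoped ComplexConjugate

noncomputable section

namespace TodaShock

/-! ### The two-sheeted surface cut along the contour -/

/-- The two sheets of the Riemann surface of `√((λ² - 1)((λ + c)² - 4d²))`. -/
inductive Sheet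
  | upper
  | lower

/-- Sheet exchange. -/
def Sheet.flip : Sheet → Sheet
  | .upper => .lower
  | .lower => .upper

/-- The side of a cut on the upper sheet: `up` is `x + i0`, `down` is `x - i0`. -/
inductive Side
  | up
  | down

/-- The opposite side of the cut. -/
def Side.flip : Side → Side
  | .up => .down
  | .down => .up

/-- The spectrum `I₁ = [-c - 2d, -c + 2d]` of the left background. -/
def bandOne (c d : ℝ) : Set ℝ := Set.Icc (-c - 2 * d) (-c + 2 * d)

/-- The spectrum `I₂ = [-1, 1]` of the right background. -/
def bandTwo : Set ℝ := Set.Icc (-1) 1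

/-- The four edges of the bands (the branch points of the surface). -/
def edges (c d : ℝ) : Set ℝ := {-c - 2 * d, -c + 2 * d, -1, 1}

/-- `I₁ ∪ I₂` as a subset of the complex plane. -/
def cuts (c d : ℝ) : Set ℂ := (fun x : ℝ => (x : ℂ)) '' (bandOne c d ∪ bandTwo)

/-- Points `(λ, ±)`, `λ ∈ ℂ ∪ {∞}`, of the surface. Only the points off the contour `Σ` over
`I₁ ∪ I₂` are used in this form; a point of `Σ` is given by `x ∈ I₁ ∪ I₂` and a `Side`. -/
abbrev SurfPt : Type := Sheet × OnePoint ℂ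

/-- The sheet exchange map `p ↦ p*`. -/
def star (p : SurfPt) : SurfPt := (p.1.flip, p.2)

/-- The surface without the contour `Σ`: two copies of `(ℂ ∪ {∞}) \ (I₁ ∪ I₂)`. -/
def offContour (c d : ℝ) : Set SurfPt :=
  {p | p.2 ∉ (fun z : ℂ => (z : OnePoint ℂ)) '' cuts c d}

/-- The local parameter `w = 1/λ` at infinity, as a map `w ↦ λ`. -/
def inftyChart (w : ℂ) : OnePoint ℂ := if w = 0 then OnePoint.infty else ((w⁻¹ : ℂ) : OnePoint ℂ)

/-- Holomorphy on the surface away from `Σ`, the points `∞₊` and `∞₋` included. -/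
def HolomorphicOffContour (c d : ℝ) (m : SurfPt → Fin 2 → ℂ) : Prop :=
  ∀ s : Sheet,
    DifferentiableOn ℂ (fun z : ℂ => m (s, (z : OnePoint ℂ))) (cuts c d)ᶜ ∧
      DifferentiableAt ℂ (fun w : ℂ => m (s, inftyChart w)) 0

open Classical in
/-- The trace on one sheet of the neighbourhoods of the boundary point `x ± i0`. At a branch point
both sides of the cut belong to every neighbourhood. -/
def approach (c d x : ℝ) (σ : Side) : Filter ℂ :=
  if x ∈ edges c d then 𝓝[(cuts c d)ᶜ] (x : ℂ)
  else
    match σ with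
    | .up => 𝓝[{z : ℂ | 0 < z.im}] (x : ℂ)
    | .down => 𝓝[{z : ℂ | z.im < 0}] (x : ℂ)

/-- `v` is the limit `m₊(p)` of `m` from the upper sheet at the point `p = (x ± i0, +)` of `Σ`. -/
def HasPlusLimit (c d : ℝ) (m : SurfPt → Fin 2 → ℂ) (x : ℝ) (σ : Side) (v : Fin 2 → ℂ) : Prop :=
  Tendsto (fun z : ℂ => m (.upper, (z : OnePoint ℂ))) (approach c d x σ) (𝓝 v)

/-- `v` is the limit `m₋(p)` of `m` from the lower sheet at the point `p = (x ± i0, +)` of `Σ`.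
The sheets are glued crosswise: `(x + i0, +)` is the same point as `(x - i0, -)`. -/
def HasMinusLimit (c d : ℝ) (m : SurfPt → Fin 2 → ℂ) (x : ℝ) (σ : Side) (v : Fin 2 → ℂ) : Prop :=
  Tendsto (fun z : ℂ => m (.lower, (z : OnePoint ℂ))) (approach c d x σ.flip) (𝓝 v)

/-! ### Vector Riemann--Hilbert problems on the surface -/

/-- Conditions common to the problem and to the associated vanishing problem, for a jump matrix `v`
on `Σ`: holomorphy off `Σ`, the jump condition `m₊ = m₋ v` at all points of `Σ` (where both limits
exist) and the symmetry condition. -/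
structure IsPreSolution (c d : ℝ) (v : ℝ → Side → Matrix (Fin 2) (Fin 2) ℂ)
    (m : SurfPt → Fin 2 → ℂ) : Prop where
  holomorphic : HolomorphicOffContour c d m
  jump : ∀ x ∈ bandOne c d ∪ bandTwo, ∀ σ : Side, ∃ mPlus mMinus : Fin 2 → ℂ,
    HasPlusLimit c d m x σ mPlus ∧ HasMinusLimit c d m x σ mMinus ∧ mPlus = mMinus ᵥ* v x σ
  symmetry : ∀ p ∈ offContour c d, m (star p) = m p ᵥ* !![0, 1; 1, 0]

/-- Solutions of the Riemann--Hilbert problem: additionally `m → (m̂, m̃)` at `∞₊` with `m̂ m̃ = 1`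
and `m̂ > 0`. -/
structure IsSolution (c d : ℝ) (v : ℝ → Side → Matrix (Fin 2) (Fin 2) ℂ)
    (m : SurfPt → Fin 2 → ℂ) : Prop extends IsPreSolution c d v m where
  normalization : ∃ (mHat : ℝ) (mTilde : ℂ),
    Tendsto (fun z : ℂ => m (.upper, (z : OnePoint ℂ))) (cocompact ℂ) (𝓝 ![(mHat : ℂ), mTilde]) ∧
      (mHat : ℂ) * mTilde = 1 ∧ 0 < mHat

/-- Solutions of the vanishing problem: the first component vanishes at `∞₊`. -/
structure IsVanishingSolution (c d : ℝ) (v : ℝ → Side → Matrix (Fin 2) (Fin 2) ℂ)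
    (m : SurfPt → Fin 2 → ℂ) : Prop extends IsPreSolution c d v m where
  vanishing : m (.upper, OnePoint.infty) 0 = 0

/-! ### Joukovski variables and phases on the contour

Parameters `α > 0`, `β` stand for the background operator `α y(n-1) + β y(n) + α y(n+1)` with
spectrum `[β - 2α, β + 2α]`: `(d, -c)` on the left and `(1/2, 0)` on the right. -/

/-- The branch of `√((λ - β)² - 4α²)` that is holomorphic off `[β - 2α, β + 2α]` and behaves like
`λ` at infinity; for real `λ` this formula gives the limit from the upper half-plane. -/
def cutRoot (α β : ℝ) (z : ℂ) : ℂ := Complex.sqrt (z - β - 2 * α) * Complex.sqrt (z - β + 2 * α)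

/-- Boundary value of `cutRoot` at `x ± i0`. -/
def rootAt (α β x : ℝ) : Side → ℂ
  | .up => cutRoot α β x
  | .down => conj (cutRoot α β x)

/-- Boundary value at `x ± i0` of the Joukovski variable
`z = (λ - β - √((λ - β)² - 4α²)) / (2α)`, which satisfies `|z| < 1` on the upper sheet. -/
def zAt (α β x : ℝ) (σ : Side) : ℂ := ((x : ℂ) - β - rootAt α β x σ) / (2 * α)

def z₁ (c d x : ℝ) (σ : Side) : ℂ := zAt d (-c) x σ

def z₂ (x : ℝ) (σ : Side) : ℂ := zAt (1 / 2) 0 x σ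

/-- Boundary values from the upper sheet of `Φ₁ = d (z₁⁻¹ - z₁) - ξ log z₁`. The principal logarithm
(with `log x = log |x| + iπ` for `x < 0`) is the limit from the lower half-plane of `λ`, and
`Φ₁` takes complex conjugate values at conjugate points. -/
def Φ₁ (c d ξ x : ℝ) : Side → ℂ
  | .down => d * ((z₁ c d x .down)⁻¹ - z₁ c d x .down) - ξ * Complex.log (z₁ c d x .down)
  | .up => conj (d * ((z₁ c d x .down)⁻¹ - z₁ c d x .down) - ξ * Complex.log (z₁ c d x .down))

/-- Boundary values from the upper sheet of `Φ₂ = (z₂ - z₂⁻¹) / 2 + ξ log z₂`. -/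
def Φ₂ (ξ x : ℝ) : Side → ℂ
  | .down => (z₂ x .down - (z₂ x .down)⁻¹) / 2 + ξ * Complex.log (z₂ x .down)
  | .up => conj ((z₂ x .down - (z₂ x .down)⁻¹) / 2 + ξ * Complex.log (z₂ x .down))

/-- Boundary values of `Φ₁` from the lower sheet, where `Φ₁(p*) = -Φ₁(p)`. -/
def Φ₁Minus (c d ξ x : ℝ) (σ : Side) : ℂ := -Φ₁ c d ξ x σ.flip

/-- Boundary values of `Φ₂` from the lower sheet, where `Φ₂(p*) = -Φ₂(p)`. -/
def Φ₂Minus (ξ x : ℝ) (σ : Side) : ℂ := -Φ₂ ξ x σ.flip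

/-! ### Scattering data of a Jacobi operator with steplike coefficients -/

/-- `H ψ = E ψ` for `(H ψ)(n) = a(n-1) ψ(n-1) + b(n) ψ(n) + a(n) ψ(n+1)`. -/
def IsJacobiSolution (a b : ℤ → ℝ) (E : ℂ) (ψ : ℤ → ℂ) : Prop :=
  ∀ n : ℤ, a (n - 1) * ψ (n - 1) + b n * ψ n + a n * ψ (n + 1) = E * ψ n

/-- The left Jost solution at `p = (x ± i0, +)`: the solution with `z₁ⁿ ψ₁(n) → 1`, `n → -∞`. -/
def IsLeftJost (c d : ℝ) (a b : ℤ → ℝ) (x : ℝ) (σ : Side) (ψ : ℤ → ℂ) : Prop :=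
  IsJacobiSolution a b x ψ ∧ Tendsto (fun n : ℤ => z₁ c d x σ ^ n * ψ n) atBot (𝓝 1)

/-- The right Jost solution at `p = (x ± i0, +)`: the solution with `z₂⁻ⁿ ψ₂(n) → 1`, `n → +∞`. -/
def IsRightJost (a b : ℤ → ℝ) (x : ℝ) (σ : Side) (ψ : ℤ → ℂ) : Prop :=
  IsJacobiSolution a b x ψ ∧ Tendsto (fun n : ℤ => z₂ x σ ^ (-n) * ψ n) atTop (𝓝 1)

def ψ₁ (c d : ℝ) (a b : ℤ → ℝ) (x : ℝ) (σ : Side) : ℤ → ℂ :=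
  Classical.epsilon (IsLeftJost c d a b x σ)

def ψ₂ (a b : ℤ → ℝ) (x : ℝ) (σ : Side) : ℤ → ℂ :=
  Classical.epsilon (IsRightJost a b x σ)

/-- The Wronskian `a(n-1) (ψ₁(n-1) ψ₂(n) - ψ₁(n) ψ₂(n-1))` of the Jost solutions, taken at `n = 1`
(it does not depend on `n`). -/
def W (c d : ℝ) (a b : ℤ → ℝ) (x : ℝ) (σ : Side) : ℂ :=
  a 0 * (ψ₁ c d a b x σ 0 * ψ₂ a b x σ 1 - ψ₁ c d a b x σ 1 * ψ₂ a b x σ 0)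

/-- The left transmission coefficient on `Σ`. -/
def T₁ (c d : ℝ) (a b : ℤ → ℝ) (x : ℝ) (σ : Side) : ℂ := -rootAt d (-c) x σ / W c d a b x σ

/-- The right transmission coefficient on `Σ`. -/
def T₂ (c d : ℝ) (a b : ℤ → ℝ) (x : ℝ) (σ : Side) : ℂ := -rootAt (1 / 2) 0 x σ / W c d a b x σ

/-- The left reflection coefficient on `Σ₁`, given by `T₁ ψ₂ = conj ψ₁ + R₁ ψ₁`. -/
def R₁ (c d : ℝ) (a b : ℤ → ℝ) (x : ℝ) (σ : Side) : ℂ :=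
  Classical.epsilon fun r : ℂ => ∀ n : ℤ,
    T₁ c d a b x σ * ψ₂ a b x σ n = conj (ψ₁ c d a b x σ n) + r * ψ₁ c d a b x σ n

/-- The right reflection coefficient on `Σ₂`, given by `T₂ ψ₁ = conj ψ₂ + R₂ ψ₂`. -/
def R₂ (c d : ℝ) (a b : ℤ → ℝ) (x : ℝ) (σ : Side) : ℂ :=
  Classical.epsilon fun r : ℂ => ∀ n : ℤ,
    T₂ c d a b x σ * ψ₁ c d a b x σ n = conj (ψ₂ a b x σ n) + r * ψ₂ a b x σ n

/-- `χ = -T₁ conj T₂` on `Σ`. -/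
def χ (c d : ℝ) (a b : ℤ → ℝ) (x : ℝ) (σ : Side) : ℂ :=
  -(T₁ c d a b x σ * conj (T₂ c d a b x σ))

/-- The admissible initial data of the Toda shock problem: positive off-diagonal coefficients,
exponentially fast convergence to the two constant backgrounds with non-overlapping spectra, no
eigenvalues, and no resonances at the edges of the spectrum. -/
structure IsShockData (c d : ℝ) (a b : ℤ → ℝ) : Prop where
  one_lt : 1 < c
  d_pos : 0 < d
  separated : 2 * d < c - 1
  a_pos : ∀ n, 0 < a n
  decay : ∃ C : ℝ,
    max (c + 2 * d + √((c + 2 * d) ^ 2 - 1))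
        (1 / (2 * d) * (1 + c + √((1 + c) ^ 2 - 4 * d ^ 2))) ≤ C ∧
      Summable (fun n : ℕ => Real.exp (C * n) * (|a (-(n : ℤ)) - d| + |b (-(n : ℤ)) + c|)) ∧
      Summable (fun n : ℕ => Real.exp (C * n) * (|a (n : ℤ) - 1 / 2| + |b (n : ℤ)|))
  no_eigenvalues : ∀ (E : ℝ) (u : ℤ → ℂ), Memℓp u 2 → IsJacobiSolution a b E u → u = 0
  no_resonances : ∀ x ∈ edges c d, ∀ σ : Side, W c d a b x σ ≠ 0

/-! ### The jump matrices -/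

/-- The jump matrix on the contour over the spectrum of the background in question. -/
def ownJump (t : ℝ) (R Φ : ℂ) : Matrix (Fin 2) (Fin 2) ℂ :=
  !![0, -conj R * Complex.exp (-(2 * t * Φ));
     R * Complex.exp (2 * t * Φ), 1]

/-- The jump matrix on the contour over the spectrum of the other background. -/
def crossJump (t : ℝ) (X ΦPlus ΦMinus : ℂ) : Matrix (Fin 2) (Fin 2) ℂ :=
  !![X * Complex.exp (t * (ΦPlus - ΦMinus)), Complex.exp (-(t * (ΦPlus + ΦMinus)));
     Complex.exp (t * (ΦPlus + ΦMinus)), 0]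

open Classical in
/-- The jump matrix `v₁` of the left problem, with `ξ = n / t`. -/
def v₁ (c d : ℝ) (a b : ℤ → ℝ) (n : ℤ) (t : ℝ) (x : ℝ) (σ : Side) : Matrix (Fin 2) (Fin 2) ℂ :=
  if x ∈ bandOne c d then ownJump t (R₁ c d a b x σ) (Φ₁ c d (n / t) x σ)
  else crossJump t (conj (χ c d a b x σ)) (Φ₁ c d (n / t) x σ) (Φ₁Minus c d (n / t) x σ)

open Classical in
/-- The jump matrix `v₂` of the right problem, with `ξ = n / t`. -/
def v₂ (c d : ℝ) (a b : ℤ → ℝ) (n : ℤ) (t : ℝ) (x : ℝ) (σ : Side) : Matrix (Fin 2) (Fin 2) ℂ :=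
  if x ∈ bandTwo then ownJump t (R₂ c d a b x σ) (Φ₂ (n / t) x σ)
  else crossJump t (χ c d a b x σ) (Φ₂ (n / t) x σ) (Φ₂Minus (n / t) x σ)

end TodaShock

end

noncomputable section

namespace TodaShock

/-! ### Solutions of Jacobi difference equations -/

/-! By linearity, uniqueness follows from the vanishing problem (`eqOn_of_vanishing`). Let (f, g) be
a vanishing solution on the upper sheet. By symmetry the lower sheet carries (g, f), so the jump
relates the limits fu, gu from the upper half-plane to the limits fd, gd from the lower one. Call a
band "own" if it belongs to the background whose phase occurs in the jump matrix, and let R be the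
root of that background.

Inside the own band the reflection coefficient is unimodular and the phase is imaginary, so fu = ρ
fd and gu = fd - ρ̄ gd with |ρ| = 1. Inside the other band ξ = n/t with integer n makes the
off-diagonal exponentials equal to 1, and the formula for χ gives fu = fd - iκR gd and gu = gd with
κ > 0.

Write f*, g* for the reflections z ↦ conj (f (conj z)), conj (g (conj z)). In the upper half-plane f
g*/R and f* g/R are holomorphic and O(|z|⁻²), because f vanishes at infinity, and their
singularities at the band edges are integrable. By Cauchy's theorem their boundary integrals are
zero (`integral_div_cutRoot_eq_zero`). Subtracting the conjugate of the second density from the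
first and multiplying by i gives |fd|²/|R| on the own band, κ|gd|² on the other one and 0 elsewhere.
A nonnegative density with integral zero vanishes, so fd = fu = 0 on the own band and gd = gu = 0 on
the other; boundary uniqueness (`eq_zero_of_boundary`) finishes `eq_zero_of_jump_relations`.

The scattering input is that W ≠ 0 inside both bands and |R_j| = 1 inside the own band
(`scattering_relation`): there one Jost solution oscillates and is independent of its conjugate,
while the other decays and has zero Wronskian with its conjugate. The Jost solutions themselves come
from a contracting Volterra equation (`exists_jost`). -/

/-- The (modified) Wronskian of two sequences. -/
def wronskian (a : ℤ → ℝ) (u v : ℤ → ℂ) (n : ℤ) : ℂ :=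
  a (n - 1) * (u (n - 1) * v n - u n * v (n - 1))

lemma wronskian_succ {a b : ℤ → ℝ} {E : ℂ} {u v : ℤ → ℂ} (hu : IsJacobiSolution a b E u)
    (hv : IsJacobiSolution a b E v) (n : ℤ) : wronskian a u v (n + 1) = wronskian a u v n := by
  have h1 := hu n
  have h2 := hv n
  simp only [wronskian, add_sub_cancel_right]
  linear_combination u n * h2 - v n * h1

lemma wronskian_eq {a b : ℤ → ℝ} {E : ℂ} {u v : ℤ → ℂ} (hu : IsJacobiSolution a b E u)
    (hv : IsJacobiSolution a b E v) (n k : ℤ) : wronskian a u v n = wronskian a u v k := by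
  have key : ∀ n : ℤ, wronskian a u v n = wronskian a u v 0 := by
    intro n
    induction n using Int.induction_on with
    | zero => rfl
    | succ i ih => rw [wronskian_succ hu hv, ih]
    | pred i ih => rw [← ih, ← wronskian_succ hu hv, sub_add_cancel]
  rw [key n, key k]

/-- Since the Wronskian is constant in n, it can be read off from the asymptotics at infinity. -/
lemma wronskian_eq_of_tendsto {a b : ℤ → ℝ} {E : ℂ} {u v : ℤ → ℂ}
    (hu : IsJacobiSolution a b E u) (hv : IsJacobiSolution a b E v) {L : ℂ}
    (h : Tendsto (wronskian a u v) atTop (𝓝 L)) (n : ℤ) : wronskian a u v n = L := by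
  have h' : Tendsto (fun _ : ℤ => wronskian a u v n) atTop (𝓝 L) :=
    h.congr fun k => wronskian_eq hu hv k n
  exact tendsto_nhds_unique tendsto_const_nhds h'

lemma IsJacobiSolution.conj {a b : ℤ → ℝ} {x : ℝ} {u : ℤ → ℂ} (hu : IsJacobiSolution a b x u) :
    IsJacobiSolution a b x (fun n => conj (u n)) := by
  intro n
  have := congrArg (starRingEnd ℂ) (hu n)
  simpa using this

/-- Reflection reduces left Jost solutions to right ones. The shift in the off-diagonal index arises
because a(n) couples the sites n and n + 1. -/
lemma IsJacobiSolution.reflect {a b : ℤ → ℝ} {E : ℂ} {u : ℤ → ℂ} (hu : IsJacobiSolution a b E u) :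
    IsJacobiSolution (fun n => a (-n - 1)) (fun n => b (-n)) E (fun n => u (-n)) := by
  intro n
  have := hu (-n)
  beta_reduce
  rw [show -(n - 1) - 1 = -n by ring, show -(n - 1) = -n + 1 by ring,
    show -(n + 1) = -n - 1 by ring]
  linear_combination this

lemma wronskian_reflect (a : ℤ → ℝ) (u v : ℤ → ℂ) (n : ℤ) :
    wronskian (fun k => a (-k - 1)) (fun k => u (-k)) (fun k => v (-k)) n =
      -wronskian a u v (1 - n) := by
  simp only [wronskian]
  rw [show -(n - 1) - 1 = -n by ring, show -(n - 1) = 1 - n by ring,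
    show 1 - n - 1 = -n by ring]
  ring

/-- A solution on a half-line extends to a solution on the whole line. -/
lemma exists_extension {a b : ℤ → ℝ} (ha : ∀ n, 0 < a n) (E : ℂ) (N : ℤ) (φ : ℤ → ℂ)
    (hφ : ∀ n > N, a (n - 1) * φ (n - 1) + b n * φ n + a n * φ (n + 1) = E * φ n) :
    ∃ ψ, IsJacobiSolution a b E ψ ∧ ∀ n ≥ N, ψ n = φ n := by
  -- The pair at step k is (ψ(N - k), ψ(N - k + 1)); the equation is solved backwards for the value
  -- at the smallest index.
  let c : ℕ → ℂ × ℂ := fun k => Nat.rec (φ N, φ (N + 1))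
    (fun k p => (((E - b (N - k)) * p.1 - a (N - k) * p.2) / a (N - k - 1), p.1)) k
  have c0 : c 0 = (φ N, φ (N + 1)) := rfl
  have cs : ∀ k : ℕ, c (k + 1) =
      (((E - b (N - k)) * (c k).1 - a (N - k) * (c k).2) / a (N - k - 1), (c k).1) := fun k => rfl
  let ψ : ℤ → ℂ := fun n => if N ≤ n then φ n else (c (N - n).toNat).1
  have hψ : ∀ n ≥ N, ψ n = φ n := fun n hn => if_pos hn
  have h1 : ∀ k : ℕ, ψ (N - k) = (c k).1 := by
    intro k
    rcases Nat.eq_zero_or_pos k with rfl | hk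
    · simp [ψ, c0]
    · have : ¬ N ≤ N - (k : ℤ) := by omega
      simp only [ψ, if_neg this]
      congr
      omega
  have h2 : ∀ k : ℕ, ψ (N - k + 1) = (c k).2 := by
    intro k
    rcases k with _ | k
    · simp [ψ, c0]
    · rw [cs, show N - ((k + 1 : ℕ) : ℤ) + 1 = N - k by push_cast; ring, h1]
  refine ⟨ψ, fun n => ?_, hψ⟩
  rcases lt_or_ge N n with hn | hn
  · rw [hψ _ (by omega), hψ _ (by omega), hψ _ (by omega)]
    exact hφ n hn
  · obtain ⟨k, rfl⟩ : ∃ k : ℕ, n = N - k := ⟨(N - n).toNat, by omega⟩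
    have h3 : ψ (N - k - 1) = (c (k + 1)).1 := by
      have := h1 (k + 1)
      rwa [show N - ((k + 1 : ℕ) : ℤ) = N - k - 1 by push_cast; ring] at this
    have hne : (a (N - k - 1) : ℂ) ≠ 0 := by exact_mod_cast (ha _).ne'
    rw [h1, h2, h3, cs]
    field_simp
    ring

/-! ### Existence of Jost solutions -/

/-- The kernel of the Volterra equation for the normalized Jost solution. -/
def jostKernel (α : ℝ) (z : ℂ) (j : ℕ) : ℂ := z / α * ∑ i ∈ Finset.range (j + 1), (z ^ 2) ^ i

lemma jostKernel_zero (α : ℝ) (z : ℂ) : jostKernel α z 0 = z / α := by simp [jostKernel]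

lemma jostKernel_succ (α : ℝ) (z : ℂ) (j : ℕ) :
    jostKernel α z (j + 1) = z / α + z ^ 2 * jostKernel α z j := by
  simp only [jostKernel]
  rw [geom_sum_succ]
  ring

/-- The closed form of the geometric sum bounds the kernel uniformly in j even for |z| = 1. Hence
plain summability of the perturbation suffices away from the band edges. -/
lemma norm_jostKernel_le (α : ℝ) {z : ℂ} (hz : ‖z‖ ≤ 1) (hz2 : z ^ 2 ≠ 1) (j : ℕ) :
    ‖jostKernel α z j‖ ≤ ‖z / α‖ * (2 / ‖z ^ 2 - 1‖) := by
  rw [jostKernel, norm_mul, geom_sum_eq hz2, norm_div ((z ^ 2) ^ (j + 1) - 1)]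
  have h : ‖(z ^ 2) ^ (j + 1)‖ ≤ 1 := by
    rw [norm_pow, norm_pow]
    exact pow_le_one₀ (by positivity) (pow_le_one₀ (norm_nonneg _) hz)
  gcongr
  calc ‖(z ^ 2) ^ (j + 1) - 1‖ ≤ ‖(z ^ 2) ^ (j + 1)‖ + ‖(1 : ℂ)‖ := norm_sub_le _ _
    _ ≤ 2 := by rw [norm_one]; linarith

/-- A summation identity behind the Volterra equation. -/
lemma jostKernel_tsum (α : ℝ) {z : ℂ} (hz : ‖z‖ ≤ 1) (hz2 : z ^ 2 ≠ 1) {q : ℕ → ℂ}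
    (hq : Summable fun n => ‖q n‖) (n : ℕ) :
    (∑' j, jostKernel α z j * q (n + j)) =
      z / α * (∑' j, q (n + j)) + z ^ 2 * ∑' j, jostKernel α z j * q (n + 1 + j) := by
  have hs : ∀ n, Summable fun j => q (n + j) := fun n => by
    have := (summable_nat_add_iff n).2 hq.of_norm
    simpa only [add_comm n] using this
  have hk : ∀ n, Summable fun j => jostKernel α z j * q (n + j) := fun n => by
    have := (summable_nat_add_iff n).2 hq
    refine Summable.of_norm_bounded
      (g := fun j => ‖z / α‖ * (2 / ‖z ^ 2 - 1‖) * ‖q (j + n)‖) (this.mul_left _) fun j => ?_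
    rw [norm_mul, add_comm n]
    gcongr
    exact norm_jostKernel_le α hz hz2 j
  rw [(hk n).tsum_eq_zero_add, (hs n).tsum_eq_zero_add]
  have e : ∀ j, jostKernel α z (j + 1) * q (n + (j + 1)) =
      z / α * q (n + 1 + j) + z ^ 2 * (jostKernel α z j * q (n + 1 + j)) := fun j => by
    rw [jostKernel_succ, show n + (j + 1) = n + 1 + j by ring]
    ring
  have e' : ∀ j, q (n + (j + 1)) = q (n + 1 + j) := fun j => by
    rw [show n + (j + 1) = n + 1 + j by ring]
  rw [tsum_congr e, tsum_congr e', jostKernel_zero]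
  rw [((hs (n + 1)).mul_left _).tsum_add ((hk (n + 1)).mul_left _), tsum_mul_left, tsum_mul_left]
  ring

open BoundedContinuousFunction in
/-- A bounded solution of the Volterra equation on a half-line with small perturbation. -/
lemma exists_volterra_solution (κ : ℕ → ℂ) (K : ℝ) (hκ : ∀ j, ‖κ j‖ ≤ K)
    (q : (ℕ → ℂ) → ℕ → ℂ) (ε : ℕ → ℝ) (hε0 : ∀ m, 0 ≤ ε m) (hε : Summable ε)
    (hsmall : K * ∑' m, ε m ≤ 1 / 2)
    (hsub : ∀ u v m, q u m - q v m = q (u - v) m)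
    (hq : ∀ u M, (∀ k, ‖u k‖ ≤ M) → ∀ m, ‖q u m‖ ≤ ε m * M) :
    ∃ u : ℕ → ℂ, ∃ M : ℝ, (∀ k, ‖u k‖ ≤ M) ∧
      ∀ k, u k = 1 + ∑' j, κ j * q u (k + j) := by
  have hK : 0 ≤ K := (norm_nonneg _).trans (hκ 0)
  have hεk : ∀ k, Summable fun j => ε (k + j) := fun k => by
    have := (summable_nat_add_iff k).2 hε
    simpa only [add_comm k] using this
  have hle : ∀ k, ∑' j, ε (k + j) ≤ ∑' m, ε m := fun k =>
    (hεk k).tsum_le_tsum_of_inj (fun j => k + j) (fun _ _ h => by simpa using h)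
      (fun m _ => hε0 m) (fun _ => le_rfl) hε
  have hbd : ∀ u M, (∀ k, ‖u k‖ ≤ M) → ∀ k j, ‖κ j * q u (k + j)‖ ≤ K * M * ε (k + j) := by
    intro u M hu k j
    rw [norm_mul]
    calc ‖κ j‖ * ‖q u (k + j)‖ ≤ K * (ε (k + j) * M) := by
          gcongr
          · exact hκ j
          · exact hq u M hu _
      _ = _ := by ring
  have hsum : ∀ u M, (∀ k, ‖u k‖ ≤ M) → ∀ k, Summable fun j => κ j * q u (k + j) :=
    fun u M hu k => Summable.of_norm_bounded ((hεk k).mul_left _) (hbd u M hu k)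
  have hT : ∀ u M, (∀ k, ‖u k‖ ≤ M) → ∀ k, ‖∑' j, κ j * q u (k + j)‖ ≤ 1 / 2 * M := by
    intro u M hu k
    have hM : 0 ≤ M := (norm_nonneg _).trans (hu 0)
    calc ‖∑' j, κ j * q u (k + j)‖ ≤ ∑' j, K * M * ε (k + j) :=
          tsum_of_norm_bounded ((hεk k).mul_left _).hasSum (hbd u M hu k)
      _ = M * (K * ∑' j, ε (k + j)) := by rw [tsum_mul_left]; ring
      _ ≤ M * (K * ∑' m, ε m) := by exact mul_le_mul_of_nonneg_left (mul_le_mul_of_nonneg_left (hle k) hK) hM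
      _ ≤ M * (1 / 2) := by gcongr
      _ = _ := by ring
  let T : (ℕ →ᵇ ℂ) → (ℕ →ᵇ ℂ) := fun u =>
    ofNormedAddCommGroupDiscrete (fun k => 1 + ∑' j, κ j * q u (k + j)) (1 + 1 / 2 * ‖u‖)
      fun k => by
        refine (norm_add_le _ _).trans ?_
        rw [norm_one]
        gcongr
        exact hT u ‖u‖ u.norm_coe_le_norm k
  have hTapp : ∀ u k, T u k = 1 + ∑' j, κ j * q u (k + j) := fun u k => rfl
  -- By linearity of q, the difference of two images is the Volterra sum of u - v, and `hT` supplies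
  -- the factor 1/2.
  have hcontr : ContractingWith (1 / 2) T := by
    refine ⟨by norm_num, LipschitzWith.of_dist_le_mul fun u v => ?_⟩
    rw [BoundedContinuousFunction.dist_le (by positivity)]
    intro k
    rw [dist_eq_norm, hTapp, hTapp, add_sub_add_left_eq_sub,
      ← (hsum u ‖u‖ u.norm_coe_le_norm k).tsum_sub (hsum v ‖v‖ v.norm_coe_le_norm k)]
    simp only [← mul_sub, hsub]
    refine (hT _ (dist u v) (fun k => ?_) k).trans (by simp)
    rw [Pi.sub_apply, ← dist_eq_norm]
    exact BoundedContinuousFunction.dist_coe_le_dist k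
  refine ⟨⇑(hcontr.fixedPoint T), ‖hcontr.fixedPoint T‖, norm_coe_le_norm _, fun k => ?_⟩
  rw [← hTapp, hcontr.fixedPoint_isFixedPt]

/-- The Jost solution of a short range perturbation of the constant background `(α, β)`. -/
theorem exists_jost {a b : ℤ → ℝ} (ha : ∀ n, 0 < a n) {α β : ℝ} (hα : α ≠ 0)
    (hsa : Summable fun n : ℕ => |a n - α|) (hsb : Summable fun n : ℕ => |b n - β|)
    {E z : ℂ} (hz0 : z ≠ 0) (hz : ‖z‖ ≤ 1) (hz2 : z ^ 2 ≠ 1) (hE : E = β + α * (z + z⁻¹)) :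
    ∃ ψ, IsJacobiSolution a b E ψ ∧ Tendsto (fun n : ℤ => z ^ (-n) * ψ n) atTop (𝓝 1) := by
  let K : ℝ := ‖z / α‖ * (2 / ‖z ^ 2 - 1‖)
  let ε : ℕ → ℝ := fun m => |a m - α| * ‖z⁻¹‖ + |b (m + 1 : ℕ) - β| + |a (m + 1 : ℕ) - α| * ‖z‖
  have hε : Summable ε :=
    ((hsa.mul_right _).add ((summable_nat_add_iff 1).2 hsb)).add
      (((summable_nat_add_iff 1).2 hsa).mul_right _)
  have hε0 : ∀ m, 0 ≤ ε m := fun m => by positivity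
  -- Starting far enough to the right makes the tail of the perturbation small enough for a
  -- contraction.
  obtain ⟨N, hN⟩ : ∃ N, K * ∑' m, ε (m + N) ≤ 1 / 2 := by
    have h := (tendsto_sum_nat_add ε).const_mul K
    rw [mul_zero] at h
    exact (h.eventually_le_const (by norm_num : (0 : ℝ) < 1 / 2)).exists
  -- Substituting ψ(n) = zⁿ u(n - N) and dividing by the middle power of z leaves the free
  -- difference operator on one side and this perturbation term on the other.
  let q : (ℕ → ℂ) → ℕ → ℂ := fun u m =>
    (α - a (m + N : ℕ)) * z⁻¹ * u m + (β - b (m + N + 1 : ℕ)) * u (m + 1) +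
      (α - a (m + N + 1 : ℕ)) * z * u (m + 2)
  have hnorm : ∀ x y : ℝ, ‖(x : ℂ) - y‖ = |y - x| := fun x y => by
    rw [← Complex.ofReal_sub, Complex.norm_real, Real.norm_eq_abs, abs_sub_comm]
  have hq : ∀ u M, (∀ k, ‖u k‖ ≤ M) → ∀ m, ‖q u m‖ ≤ ε (m + N) * M := by
    intro u M hu m
    have : ε (m + N) * M = |a (m + N : ℕ) - α| * ‖z⁻¹‖ * M + |b (m + N + 1 : ℕ) - β| * M +
      |a (m + N + 1 : ℕ) - α| * ‖z‖ * M := by simp only [ε]; ring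
    rw [this]
    refine (norm_add₃_le).trans ?_
    simp only [norm_mul, hnorm]
    gcongr <;> exact hu _
  have hεN : Summable fun m => ε (m + N) := (summable_nat_add_iff N).2 hε
  obtain ⟨u, M, hM, hu⟩ := exists_volterra_solution (jostKernel α z) K
    (norm_jostKernel_le α hz hz2) q (fun m => ε (m + N)) (fun m => hε0 _) hεN hN
    (fun u v m => by simp only [q, Pi.sub_apply]; ring) hq
  have hqs : Summable fun m => ‖q u m‖ :=
    Summable.of_nonneg_of_le (fun _ => norm_nonneg _) (hq u M hM) (hεN.mul_right M)
  have hα' : (α : ℂ) ≠ 0 := by exact_mod_cast hα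
  -- the three-term recurrence for `u`
  have hrec : ∀ k, α * (z⁻¹ * (u k - u (k + 1)) + z * (u (k + 2) - u (k + 1))) = q u k := by
    intro k
    have h1 := jostKernel_tsum α hz hz2 hqs k
    have h2 := jostKernel_tsum α hz hz2 hqs (k + 1)
    have h3 : ∑' j, q u (k + j) = q u k + ∑' j, q u (k + 1 + j) := by
      have hs : Summable fun j => q u (k + j) := by
        have := (summable_nat_add_iff k).2 hqs.of_norm
        simpa only [add_comm k] using this
      rw [hs.tsum_eq_zero_add]
      simp only [add_zero, add_assoc, add_comm 1]
    rw [h3] at h1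
    rw [hu k, hu (k + 1), hu (k + 2)]
    rw [show k + 1 + 1 = k + 2 by ring] at h2
    generalize (∑' j, jostKernel α z j * q u (k + j)) = A at *
    generalize (∑' j, jostKernel α z j * q u (k + 1 + j)) = B at *
    generalize (∑' j, jostKernel α z j * q u (k + 2 + j)) = C at *
    generalize (∑' j, q u (k + 1 + j)) = S at *
    field_simp at h1 h2 ⊢
    linear_combination h1 - h2
  have hlim : Tendsto u atTop (𝓝 1) := by
    have hb : ∀ k, ‖u k - 1‖ ≤ ∑' j, K * ‖q u (j + k)‖ := by
      intro k
      rw [hu k, add_sub_cancel_left]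
      refine tsum_of_norm_bounded (((summable_nat_add_iff k).2 hqs).mul_left K).hasSum fun j => ?_
      rw [norm_mul, add_comm k]
      gcongr
      exact norm_jostKernel_le α hz hz2 j
    rw [tendsto_iff_norm_sub_tendsto_zero]
    refine squeeze_zero (fun _ => norm_nonneg _) hb ?_
    simp only [tsum_mul_left]
    simpa using (tendsto_sum_nat_add fun m => ‖q u m‖).const_mul K
  let φ : ℤ → ℂ := fun n => z ^ n * u (n - N).toNat
  obtain ⟨ψ, hψ, hψφ⟩ := exists_extension (b := b) ha E N φ (by
    intro n hn
    obtain ⟨k, rfl⟩ : ∃ k : ℕ, n = (N : ℤ) + k + 1 := ⟨(n - N - 1).toNat, by omega⟩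
    have hk := hrec k
    simp only [φ, q] at hk ⊢
    rw [show ((N : ℤ) + k + 1 - 1 - N).toNat = k by omega,
      show ((N : ℤ) + k + 1 - N).toNat = k + 1 by omega,
      show ((N : ℤ) + k + 1 + 1 - N).toNat = k + 2 by omega,
      show (N : ℤ) + k + 1 - 1 = (N : ℤ) + k by ring, hE]
    rw [show ((k + N : ℕ) : ℤ) = (N : ℤ) + k by push_cast; ring,
      show ((k + N + 1 : ℕ) : ℤ) = (N : ℤ) + k + 1 by push_cast; ring] at hk
    have e1 : z ^ ((N : ℤ) + k + 1 + 1) = z ^ ((N : ℤ) + k) * z ^ 2 := by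
      rw [zpow_add_one₀ hz0, zpow_add_one₀ hz0]; ring
    rw [e1, zpow_add_one₀ hz0]
    generalize z ^ ((N : ℤ) + k) = Z
    field_simp at hk ⊢
    linear_combination Z * hk)
  refine ⟨ψ, hψ, ?_⟩
  have hl : Tendsto (fun n : ℤ => u (n - N).toNat) atTop (𝓝 1) := by
    refine hlim.comp ?_
    rw [tendsto_atTop]
    intro m
    filter_upwards [eventually_ge_atTop ((N : ℤ) + m)] with n hn
    omega
  refine hl.congr' ?_
  filter_upwards [eventually_ge_atTop (N : ℤ)] with n hn
  rw [hψφ n hn]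
  simp only [φ]
  rw [← mul_assoc, ← zpow_add₀ hz0, neg_add_cancel, zpow_zero, one_mul]

/-! ### Asymptotics of Wronskians -/

lemma tendsto_coeff {a : ℤ → ℝ} {α : ℝ} (hsa : Summable fun n : ℕ => |a n - α|) :
    Tendsto (fun n : ℤ => (a (n - 1) : ℂ)) atTop (𝓝 α) := by
  have h1 : Tendsto (fun n : ℕ => a n) atTop (𝓝 α) := by
    rw [tendsto_iff_norm_sub_tendsto_zero]
    simpa using hsa.tendsto_atTop_zero
  have h2 : Tendsto (fun n : ℤ => (n - 1).toNat) atTop atTop := by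
    rw [tendsto_atTop]
    intro m
    filter_upwards [eventually_ge_atTop ((m : ℤ) + 1)] with n hn
    omega
  refine (Complex.continuous_ofReal.tendsto α).comp ((h1.comp h2).congr' ?_)
  filter_upwards [eventually_ge_atTop 1] with n hn
  simp only [Function.comp_apply]
  rw [show (((n - 1).toNat : ℕ) : ℤ) = n - 1 by omega]

lemma tendsto_shift {u : ℤ → ℂ} {L : ℂ} (h : Tendsto u atTop (𝓝 L)) :
    Tendsto (fun n => u (n - 1)) atTop (𝓝 L) :=
  h.comp (tendsto_atTop_add_const_right atTop (-1) tendsto_id)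

/-- The Wronskian of an oscillating Jost solution and its conjugate. -/
lemma wronskian_conj_of_norm_eq_one {a b : ℤ → ℝ} {α x : ℝ}
    (hsa : Summable fun n : ℕ => |a n - α|) {z : ℂ} (hz : ‖z‖ = 1) {ψ : ℤ → ℂ}
    (hψ : IsJacobiSolution a b x ψ) (hl : Tendsto (fun n : ℤ => z ^ (-n) * ψ n) atTop (𝓝 1))
    (n : ℤ) : wronskian a ψ (fun k => conj (ψ k)) n = α * (z⁻¹ - z) := by
  refine wronskian_eq_of_tendsto hψ hψ.conj ?_ n
  have hz0 : z ≠ 0 := by rintro rfl; simp at hz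
  have hc : conj z = z⁻¹ := (Complex.inv_eq_conj hz).symm
  have hl' := (Complex.continuous_conj.tendsto 1).comp hl
  have h := (tendsto_coeff hsa).mul
    ((((tendsto_shift hl).mul hl').const_mul z⁻¹).sub ((hl.mul (tendsto_shift hl')).const_mul z))
  simp only [map_one, mul_one] at h
  refine h.congr fun k => ?_
  have hzk : z ^ k ≠ 0 := zpow_ne_zero _ hz0
  simp only [wronskian, Function.comp_apply, map_mul, map_zpow₀, hc]
  rw [show -(k - 1) = -k + 1 by ring, zpow_add_one₀ hz0, zpow_add_one₀ (inv_ne_zero hz0)]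
  simp only [_root_.zpow_neg, _root_.inv_zpow, inv_inv]
  field_simp

/-- The Wronskian of a decaying Jost solution and its conjugate. -/
lemma wronskian_conj_of_norm_lt_one {a b : ℤ → ℝ} {α x : ℝ}
    (hsa : Summable fun n : ℕ => |a n - α|) {z : ℂ} (hz0 : z ≠ 0) (hz : ‖z‖ < 1) {ψ : ℤ → ℂ}
    (hψ : IsJacobiSolution a b x ψ) (hl : Tendsto (fun n : ℤ => z ^ (-n) * ψ n) atTop (𝓝 1))
    (n : ℤ) : wronskian a ψ (fun k => conj (ψ k)) n = 0 := by
  refine wronskian_eq_of_tendsto hψ hψ.conj ?_ n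
  have hpow : Tendsto (fun n : ℤ => z ^ n) atTop (𝓝 0) := by
    have h2 : Tendsto (fun n : ℤ => n.toNat) atTop atTop := by
      rw [tendsto_atTop]
      intro m
      filter_upwards [eventually_ge_atTop (m : ℤ)] with n hn
      omega
    refine ((tendsto_pow_atTop_nhds_zero_of_norm_lt_one hz).comp h2).congr' ?_
    filter_upwards [eventually_ge_atTop 0] with n hn
    simp only [Function.comp_apply]
    rw [← zpow_natCast, Int.toNat_of_nonneg hn]
  have h0 : Tendsto ψ atTop (𝓝 0) := by
    have h := hpow.mul hl
    rw [zero_mul] at h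
    refine h.congr fun k => ?_
    rw [← mul_assoc, ← zpow_add₀ hz0, add_neg_cancel, zpow_zero, one_mul]
  have h0' := (Complex.continuous_conj.tendsto 0).comp h0
  rw [map_zero] at h0'
  have h := (tendsto_coeff hsa).mul
    (((tendsto_shift h0).mul h0').sub (h0.mul (tendsto_shift h0')))
  simp only [mul_zero, sub_zero] at h
  exact h

/-! ### Scattering relations on a band of multiplicity one -/

/-- If `ψ, ψ̄` are linearly independent and `φ ≠ 0` has `wronskian φ φ̄ = 0`, then `φ` is a multiple
of `ψ̄ + r ψ` with `|r| = 1`. -/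
lemma scattering_relation {a b : ℤ → ℝ} {x : ℝ} {ψ φ : ℤ → ℂ} {w : ℂ} (hw : w ≠ 0)
    (hψ : IsJacobiSolution a b x ψ) (hφ : IsJacobiSolution a b x φ)
    (hψw : ∀ n, wronskian a ψ (fun k => conj (ψ k)) n = w)
    (hφw : ∀ n, wronskian a φ (fun k => conj (φ k)) n = 0) (hφ0 : ∃ n, φ n ≠ 0) :
    wronskian a ψ φ 1 ≠ 0 ∧ ∃ r : ℂ, ‖r‖ = 1 ∧
      ∀ n, w / wronskian a ψ φ 1 * φ n = conj (ψ n) + r * ψ n := by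
  set B := wronskian a ψ φ 1 with hB
  set A := wronskian a φ (fun k => conj (ψ k)) 1 with hA
  -- Expansion of φ in the basis ψ, ψ̄, with the coefficients given by Wronskians evaluated at the
  -- common index n.
  have hrel : ∀ n, w * φ n = A * ψ n + B * conj (ψ n) := by
    intro n
    rw [← hψw n, hA, hB, wronskian_eq hφ hψ.conj 1 n, wronskian_eq hψ hφ 1 n]
    simp only [wronskian]
    ring
  -- By the Plücker identity |A|² - |B|² is, up to sign, the product of the Wronskians of (ψ, ψ̄)
  -- and (φ, φ̄), and the latter is zero.
  have hAB : ‖A‖ = ‖B‖ := by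
    have h : A * conj A = B * conj B := by
      have h1 := hψw 1
      have h2 := hφw 1
      simp only [wronskian] at h1 h2
      rw [hA, hB]
      simp only [wronskian, map_mul, map_sub, Complex.conj_conj, Complex.conj_ofReal]
      linear_combination (a (1 - 1) * (ψ (1 - 1) * conj (ψ 1) - ψ 1 * conj (ψ (1 - 1)))) * (-h2)
    rw [Complex.mul_conj', Complex.mul_conj'] at h
    have h' : ‖A‖ ^ 2 = ‖B‖ ^ 2 := by exact_mod_cast h
    exact (pow_left_inj₀ (norm_nonneg _) (norm_nonneg _) two_ne_zero).1 h'
  have hB0 : B ≠ 0 := by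
    intro h0
    have hA0 : A = 0 := by rw [← norm_eq_zero, hAB, h0, norm_zero]
    obtain ⟨n, hn⟩ := hφ0
    have := hrel n
    rw [hA0, h0, zero_mul, zero_mul, add_zero] at this
    exact (mul_ne_zero hw hn) this
  refine ⟨hB0, A / B, ?_, fun n => ?_⟩
  · rw [norm_div, hAB, div_self (norm_ne_zero_iff.2 hB0)]
  · have := hrel n
    field_simp
    linear_combination this

lemma exists_ne_zero_of_jost {z : ℂ} {ψ : ℤ → ℂ}
    (hl : Tendsto (fun n : ℤ => z ^ (-n) * ψ n) atTop (𝓝 1)) : ∃ n, ψ n ≠ 0 := by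
  by_contra! h
  simp only [h, mul_zero] at hl
  exact zero_ne_one (tendsto_nhds_unique tendsto_const_nhds hl)

/-! ### Holomorphic functions on the upper half-plane with boundary values -/

/-- The open upper half-plane. -/
def upperHalf : Set ℂ := {z : ℂ | 0 < z.im}

lemma isOpen_upperHalf : IsOpen upperHalf := isOpen_lt continuous_const Complex.continuous_im

lemma closure_upperHalf : closure upperHalf = {z : ℂ | 0 ≤ z.im} := Complex.closure_setOfPred_lt_im 0

lemma convex_upperHalf : Convex ℝ upperHalf := convex_halfSpace_im_gt 0

lemma ofReal_mem_closure_upperHalf (x : ℝ) : (x : ℂ) ∈ closure upperHalf := by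
  rw [closure_upperHalf]
  simp

instance neBot_nhdsWithin_upperHalf (x : ℝ) : (𝓝[upperHalf] (x : ℂ)).NeBot :=
  mem_closure_iff_nhdsWithin_neBot.1 (ofReal_mem_closure_upperHalf x)

/-- `φ` is holomorphic on the upper half-plane, with limit `φ₀ x` at every real `x`. -/
structure HasBoundaryValues (φ : ℂ → ℂ) (φ₀ : ℝ → ℂ) : Prop where
  differentiableOn : DifferentiableOn ℂ φ upperHalf
  tendsto : ∀ x : ℝ, Tendsto φ (𝓝[upperHalf] (x : ℂ)) (𝓝 (φ₀ x))

namespace HasBoundaryValues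

variable {φ : ℂ → ℂ} {φ₀ : ℝ → ℂ}

/-- The limits are taken through full half-plane neighbourhoods of every real point, so they fit
together to a continuous extension. Continuity of the boundary function and local bounds follow. -/
lemma continuousOn_extendFrom (h : HasBoundaryValues φ φ₀) :
    ContinuousOn (extendFrom upperHalf φ) {z : ℂ | 0 ≤ z.im} := by
  rw [← closure_upperHalf]
  refine _root_.continuousOn_extendFrom subset_rfl fun z hz => ?_
  rw [closure_upperHalf] at hz
  rcases (show (0 : ℝ) ≤ z.im from hz).lt_or_eq with hz | hz
  · exact ⟨φ z, h.differentiableOn.continuousOn z hz⟩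
  · obtain ⟨x, rfl⟩ : ∃ x : ℝ, z = x := ⟨z.re, Complex.ext rfl (by simp [← hz])⟩
    exact ⟨_, h.tendsto _⟩

lemma extendFrom_of_mem (h : HasBoundaryValues φ φ₀) {z : ℂ} (hz : z ∈ upperHalf) :
    extendFrom upperHalf φ z = φ z :=
  extendFrom_extends h.differentiableOn.continuousOn z hz

lemma extendFrom_ofReal (h : HasBoundaryValues φ φ₀) (x : ℝ) :
    extendFrom upperHalf φ x = φ₀ x :=
  extendFrom_eq (ofReal_mem_closure_upperHalf x) (h.tendsto x)

lemma continuous (h : HasBoundaryValues φ φ₀) : Continuous φ₀ := by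
  have : Continuous fun x : ℝ => extendFrom upperHalf φ x :=
    h.continuousOn_extendFrom.comp_continuous Complex.continuous_ofReal fun x => by simp
  simpa only [h.extendFrom_ofReal] using this

lemma exists_bound (h : HasBoundaryValues φ φ₀) (w : ℂ) (L : ℝ) :
    ∃ M, ∀ z : ℂ, 0 ≤ z.im → ‖z - w‖ ≤ L → ‖extendFrom upperHalf φ z‖ ≤ M := by
  have hc : IsCompact (Metric.closedBall w L ∩ {z : ℂ | 0 ≤ z.im}) :=
    (isCompact_closedBall _ _).inter_right (isClosed_le continuous_const Complex.continuous_im)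
  obtain ⟨M, hM⟩ := hc.exists_bound_of_continuousOn
    (h.continuousOn_extendFrom.mono Set.inter_subset_right)
  exact ⟨M, fun z hz hz' => hM z ⟨by rwa [Metric.mem_closedBall, dist_eq_norm], hz⟩⟩

/-- Boundary uniqueness: a holomorphic function whose boundary values vanish on an interval is
zero. -/
theorem eq_zero_of_boundary (h : HasBoundaryValues φ φ₀) {p q : ℝ} (hpq : p < q)
    (h0 : ∀ x ∈ Set.Ioo p q, φ₀ x = 0) : ∀ z ∈ upperHalf, φ z = 0 := by
  set x₀ : ℝ := (p + q) / 2 with hx₀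
  set δ : ℝ := (q - p) / 4 with hδ
  have hδ0 : 0 < δ := by rw [hδ]; linarith
  set ψ := extendFrom upperHalf φ with hψ
  obtain ⟨M, hM⟩ := h.exists_bound x₀ δ
  have hM0 : 0 ≤ M := (norm_nonneg _).trans (hM x₀ (by simp) (by simpa using hδ0.le))
  set U : Set ℂ := Metric.ball (x₀ : ℂ) δ ∩ upperHalf with hU
  have hUo : IsOpen U := Metric.isOpen_ball.inter isOpen_upperHalf
  have hUcl : closure U ⊆ Metric.closedBall (x₀ : ℂ) δ ∩ {z : ℂ | 0 ≤ z.im} := by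
    refine (closure_inter_subset_inter_closure _ _).trans ?_
    rw [closure_upperHalf]
    exact Set.inter_subset_inter_left _ Metric.closure_ball_subset_closedBall
  -- Weight for the maximum principle on a half-disc. On the arc the exponent has real part at most
  -- -Aδ², while on the vertical radius at height y it is A((y - δ)² - δ²), which is larger. Letting
  -- A → ∞ forces φ to vanish on that radius, and the identity theorem does the rest.
  let e : ℝ → ℂ → ℂ := fun A z =>
    Complex.exp (A * (-(z - x₀) ^ 2 + 2 * δ * Complex.I * (z - x₀)))
  have hnorm : ∀ A z, ‖e A z‖ = Real.exp (A * (-(z.re - x₀) ^ 2 + z.im ^ 2 - 2 * δ * z.im)) := by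
    intro A z
    simp only [e, Complex.norm_exp]
    congr 1
    simp only [pow_two, Complex.mul_re, Complex.mul_im, Complex.add_re, Complex.add_im,
      Complex.neg_re, Complex.neg_im, Complex.sub_re, Complex.sub_im, Complex.ofReal_re,
      Complex.ofReal_im, Complex.I_re, Complex.I_im, Complex.re_ofNat, Complex.im_ofNat]
    ring
  have hdc : ∀ A, DiffContOnCl ℂ (fun z => ψ z * e A z) U := by
    intro A
    have he : Differentiable ℂ (e A) := by
      simp only [e]
      fun_prop
    have hψd : DiffContOnCl ℂ ψ U := by
      refine ⟨?_, h.continuousOn_extendFrom.mono (hUcl.trans Set.inter_subset_right)⟩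
      exact (h.differentiableOn.mono Set.inter_subset_right).congr fun z hz =>
        h.extendFrom_of_mem hz.2
    exact hψd.smul he.diffContOnCl
  have hfr : ∀ A : ℝ, 0 ≤ A → ∀ z ∈ frontier U, ‖ψ z * e A z‖ ≤ M * Real.exp (-A * δ ^ 2) := by
    intro A hA z hz
    obtain ⟨hzc, hzi⟩ := hUcl hz.1
    have hzi : 0 ≤ z.im := hzi
    rw [Metric.mem_closedBall, dist_eq_norm] at hzc
    have hzn : z ∉ U := fun hmem => hz.2 (hUo.interior_eq.symm ▸ hmem)
    rcases hzi.eq_or_lt with hi | hi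
    · obtain ⟨x, rfl⟩ : ∃ x : ℝ, z = x := ⟨z.re, Complex.ext rfl (by simp [← hi])⟩
      rw [← Complex.ofReal_sub, Complex.norm_real, Real.norm_eq_abs, abs_le] at hzc
      rw [hψ, h.extendFrom_ofReal, h0 x ⟨by linarith [hzc.1], by linarith [hzc.2]⟩, zero_mul,
        norm_zero]
      positivity
    · have hzδ : ‖z - x₀‖ = δ := by
        refine le_antisymm hzc (not_lt.1 fun hlt => hzn ⟨?_, hi⟩)
        rwa [Metric.mem_ball, dist_eq_norm]
      have hsq : (z.re - x₀) ^ 2 + z.im ^ 2 = δ ^ 2 := by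
        rw [← hzδ, Complex.sq_norm, Complex.normSq_apply]
        simp
        ring
      have him : z.im ≤ δ := by
        nlinarith [sq_nonneg (z.re - x₀)]
      rw [norm_mul, hnorm]
      have : A * (-(z.re - x₀) ^ 2 + z.im ^ 2 - 2 * δ * z.im) ≤ -A * δ ^ 2 := by
        have h1 : -(z.re - x₀) ^ 2 + z.im ^ 2 - 2 * δ * z.im ≤ -δ ^ 2 := by nlinarith
        nlinarith
      gcongr
      exact hM z hzi hzc
  have hseg : ∀ y ∈ Set.Ioo 0 δ, φ (x₀ + y * Complex.I) = 0 := by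
    intro y hy
    set z : ℂ := x₀ + y * Complex.I with hz
    have hre : z.re = x₀ := by simp [hz]
    have him : z.im = y := by simp [hz]
    have hzU : z ∈ U := by
      refine ⟨?_, ?_⟩
      · rw [Metric.mem_ball, dist_eq_norm, hz]
        simpa [abs_of_pos hy.1] using hy.2
      · simpa only [upperHalf, Set.mem_ofPred_eq, him] using hy.1
    have hb : ∀ A : ℝ, 0 ≤ A → ‖φ z‖ ≤ M * Real.exp (-(A * (y - δ) ^ 2)) := by
      intro A hA
      have := Complex.norm_le_of_forall_mem_frontier_norm_le
        (Metric.isBounded_ball.subset Set.inter_subset_left) (hdc A) (hfr A hA)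
        (subset_closure hzU)
      rw [norm_mul, hnorm, hψ, h.extendFrom_of_mem hzU.2, hre, him] at this
      have hpos : 0 < Real.exp (A * (-(x₀ - x₀) ^ 2 + y ^ 2 - 2 * δ * y)) := Real.exp_pos _
      refine le_of_mul_le_mul_right (this.trans (le_of_eq ?_)) hpos
      rw [mul_assoc, ← Real.exp_add]
      congr 2
      ring
    have hlim : Tendsto (fun A : ℝ => M * Real.exp (-(A * (y - δ) ^ 2))) atTop (𝓝 (M * 0)) := by
      refine Tendsto.const_mul _ (Real.tendsto_exp_neg_atTop_nhds_zero.comp ?_)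
      refine tendsto_id.atTop_mul_const ?_
      have : y - δ ≠ 0 := by linarith [hy.2]
      positivity
    rw [mul_zero] at hlim
    have := ge_of_tendsto hlim ((eventually_ge_atTop 0).mono hb)
    exact norm_le_zero_iff.1 this
  have han : AnalyticOnNhd ℂ φ upperHalf := h.differentiableOn.analyticOnNhd isOpen_upperHalf
  have hmem : ((x₀ : ℂ) + (δ / 2 : ℝ) * Complex.I) ∈ upperHalf := by
    simp only [upperHalf, Set.mem_ofPred_eq]
    simpa using hδ0
  refine han.eqOn_zero_of_preconnected_of_frequently_eq_zero convex_upperHalf.isPreconnected hmem ?_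
  have ht : Tendsto (fun y : ℝ => (x₀ : ℂ) + y * Complex.I) (𝓝[≠] (δ / 2))
      (𝓝[≠] ((x₀ : ℂ) + (δ / 2 : ℝ) * Complex.I)) := by
    refine tendsto_nhdsWithin_of_tendsto_nhds_of_eventually_within _ ?_ ?_
    · exact (Continuous.tendsto (by fun_prop) _).mono_left nhdsWithin_le_nhds
    · filter_upwards [self_mem_nhdsWithin] with y hy heq
      apply hy
      have := congrArg Complex.im heq
      simpa using this
  refine ht.frequently (Eventually.frequently ?_)
  filter_upwards [nhdsWithin_le_nhds (Ioo_mem_nhds (half_pos hδ0) (half_lt_self hδ0))] with y hy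
  exact hseg y hy

end HasBoundaryValues

/-! ### Integrals of boundary values -/

lemma tendsto_vertical (x : ℝ) :
    Tendsto (fun y : ℝ => (x : ℂ) + y * Complex.I) (𝓝[>] 0) (𝓝[upperHalf] (x : ℂ)) := by
  refine tendsto_nhdsWithin_of_tendsto_nhds_of_eventually_within _ ?_ ?_
  · have : Tendsto (fun y : ℝ => (x : ℂ) + y * Complex.I) (𝓝 0)
        (𝓝 ((x : ℂ) + (0 : ℝ) * Complex.I)) := Continuous.tendsto (by fun_prop) _
    simpa using this.mono_left nhdsWithin_le_nhds
  · filter_upwards [self_mem_nhdsWithin] with y hy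
    simpa [upperHalf] using hy

open MeasureTheory in
/-- A holomorphic function on the upper half-plane that decays quadratically has vanishing
integrals over horizontal lines. -/
lemma integral_horizontal_eq_zero {G : ℂ → ℂ} (hG : DifferentiableOn ℂ G upperHalf) {C L : ℝ}
    (hdec : ∀ z ∈ upperHalf, L ≤ ‖z‖ → ‖G z‖ ≤ C / ‖z‖ ^ 2) {y : ℝ} (hy : 0 < y)
    (hint : Integrable fun x : ℝ => G (x + y * Complex.I)) :
    ∫ x : ℝ, G (x + y * Complex.I) = 0 := by
  have h1 : Tendsto (fun R : ℝ => ∫ x in (-R)..R, G (x + y * Complex.I)) atTop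
      (𝓝 (∫ x : ℝ, G (x + y * Complex.I))) :=
    intervalIntegral_tendsto_integral hint tendsto_neg_atTop_atBot tendsto_id
  have hC : 0 ≤ C := by
    have hz : ((max L 1 : ℝ) : ℂ) * Complex.I ∈ upperHalf := by simp [upperHalf]
    have hn : ‖((max L 1 : ℝ) : ℂ) * Complex.I‖ = max L 1 := by
      rw [norm_mul, Complex.norm_I, mul_one, Complex.norm_real, Real.norm_eq_abs,
        abs_of_pos (by positivity)]
    have := (norm_nonneg _).trans (hdec _ hz (by rw [hn]; exact le_max_left _ _))
    rw [hn] at this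
    by_contra hneg
    exact absurd this (not_le.2 (div_neg_of_neg_of_pos (not_le.1 hneg) (by positivity)))
  -- Cauchy's theorem on the rectangle [-R, R] × [y, R]: the other three sides have total length at
  -- most 4R, and the integrand there is at most C/R².
  have hb : ∀ R : ℝ, max L (max y 1) ≤ R →
      ‖∫ x in (-R)..R, G (x + y * Complex.I)‖ ≤ 4 * C * R⁻¹ := by
    intro R hR
    have hRL : L ≤ R := (le_max_left _ _).trans hR
    have hRy : y ≤ R := (le_max_left _ _).trans ((le_max_right _ _).trans hR)
    have hR1 : 1 ≤ R := (le_max_right _ _).trans ((le_max_right _ _).trans hR)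
    have hR0 : 0 < R := by linarith
    have hdec' : ∀ z ∈ upperHalf, R ≤ ‖z‖ → ‖G z‖ ≤ C / R ^ 2 := fun z hz hzR =>
      (hdec z hz (hRL.trans hzR)).trans (by gcongr)
    have hrect := Complex.integral_boundary_rect_eq_zero_of_differentiableOn G
      ⟨-R, y⟩ ⟨R, R⟩ (hG.mono fun z hz => by
        have := hz.2
        simp only [Set.mem_preimage, Set.uIcc_of_le hRy] at this
        exact hy.trans_le this.1)
    simp only at hrect
    have htop : ‖∫ x in (-R)..R, G (x + R * Complex.I)‖ ≤ C / R ^ 2 * |R - -R| := by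
      refine intervalIntegral.norm_integral_le_of_norm_le_const fun x _ => hdec' _ ?_ ?_
      · simpa [upperHalf] using hR0
      · calc R = |((x : ℂ) + R * Complex.I).im| := by simp [abs_of_pos hR0]
          _ ≤ _ := Complex.abs_im_le_norm _
    have hside : ∀ s : ℝ, |s| = R →
        ‖∫ v in y..R, G (s + v * Complex.I)‖ ≤ C / R ^ 2 * |R - y| := by
      intro s hs
      refine intervalIntegral.norm_integral_le_of_norm_le_const fun v hv => hdec' _ ?_ ?_
      · rw [Set.uIoc_of_le hRy] at hv
        simpa [upperHalf] using hy.trans hv.1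
      · calc R = |((s : ℂ) + v * Complex.I).re| := by simp [hs]
          _ ≤ _ := Complex.abs_re_le_norm _
    have hr := hside R (abs_of_pos hR0)
    have hl := hside (-R) (by rw [abs_neg, abs_of_pos hR0])
    have heq : ∫ x in (-R)..R, G (x + y * Complex.I) =
        (∫ x in (-R)..R, G (x + R * Complex.I)) -
          Complex.I • (∫ v in y..R, G ((R : ℝ) + v * Complex.I)) +
          Complex.I • (∫ v in y..R, G ((-R : ℝ) + v * Complex.I)) := by
      linear_combination hrect
    rw [heq]
    have hCR : 0 ≤ C / R ^ 2 := by positivity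
    have hRy' : |R - y| ≤ R := by rw [abs_of_nonneg (by linarith)]; linarith
    calc _ ≤ C / R ^ 2 * |R - -R| + C / R ^ 2 * |R - y| + C / R ^ 2 * |R - y| := by
          refine (norm_add_le _ _).trans (add_le_add ((norm_sub_le _ _).trans
            (add_le_add htop ?_)) ?_)
          · rwa [norm_smul, Complex.norm_I, one_mul]
          · rwa [norm_smul, Complex.norm_I, one_mul]
      _ ≤ C / R ^ 2 * (2 * R) + C / R ^ 2 * R + C / R ^ 2 * R := by
          gcongr
          rw [abs_of_nonneg (by linarith)]
          linarith
      _ = 4 * C * R⁻¹ := by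
          field_simp
          ring
  have h2 : Tendsto (fun R : ℝ => ∫ x in (-R)..R, G (x + y * Complex.I)) atTop (𝓝 0) := by
    refine squeeze_zero_norm' ((eventually_ge_atTop _).mono hb) ?_
    simpa using tendsto_inv_atTop_zero.const_mul (4 * C)
  exact tendsto_nhds_unique h1 h2

open MeasureTheory in
/-- The boundary values of a quadratically decaying holomorphic function on the upper half-plane
have integral zero. -/
theorem integral_boundary_eq_zero {G : ℂ → ℂ} {G₀ : ℝ → ℂ} {h : ℝ → ℝ}
    (hG : DifferentiableOn ℂ G upperHalf) {C L : ℝ}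
    (hdec : ∀ z ∈ upperHalf, L ≤ ‖z‖ → ‖G z‖ ≤ C / ‖z‖ ^ 2) (hh : Integrable h)
    (hdom : ∀ᵐ x : ℝ, ∀ y ∈ Set.Ioo (0 : ℝ) 1, ‖G (x + y * Complex.I)‖ ≤ h x)
    (hlim : ∀ᵐ x : ℝ, Tendsto (fun y : ℝ => G (x + y * Complex.I)) (𝓝[>] 0) (𝓝 (G₀ x))) :
    Integrable G₀ ∧ ∫ x, G₀ x = 0 := by
  have hIoo : Set.Ioo (0 : ℝ) 1 ∈ 𝓝[>] (0 : ℝ) := Ioo_mem_nhdsGT one_pos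
  have hmeas : ∀ y : ℝ, 0 < y → AEStronglyMeasurable (fun x : ℝ => G (x + y * Complex.I)) := by
    intro y hy
    refine (hG.continuousOn.comp_continuous (by fun_prop) fun x => ?_).aestronglyMeasurable
    simpa [upperHalf] using hy
  have hmeas' : ∀ᶠ y : ℝ in 𝓝[>] (0 : ℝ),
      AEStronglyMeasurable (fun x : ℝ => G (x + (y : ℝ) * Complex.I)) := by
    filter_upwards [self_mem_nhdsWithin] with y hy using hmeas y hy
  have hdom' : ∀ y ∈ Set.Ioo (0 : ℝ) 1, ∀ᵐ x : ℝ, ‖G (x + y * Complex.I)‖ ≤ h x :=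
    fun y hy => hdom.mono fun x hx => hx y hy
  have hlim0 := tendsto_integral_filter_of_dominated_convergence h hmeas'
    (by filter_upwards [hIoo] with y hy using hdom' y hy) hh hlim
  have hzero : ∀ᶠ y : ℝ in 𝓝[>] (0 : ℝ), ∫ x : ℝ, G (x + y * Complex.I) = 0 := by
    filter_upwards [hIoo] with y hy
    exact integral_horizontal_eq_zero hG hdec hy.1 (hh.mono' (hmeas y hy.1) (hdom' y hy))
  refine ⟨?_, tendsto_nhds_unique hlim0 (tendsto_const_nhds.congr' (hzero.mono fun y hy => hy.symm))⟩
  -- A sequence of heights is needed because measurability passes to the limit along a countably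
  -- generated approach.
  have hseq : Tendsto (fun n : ℕ => 1 / ((n : ℝ) + 1)) atTop (𝓝[>] 0) :=
    tendsto_nhdsWithin_of_tendsto_nhds_of_eventually_within _ tendsto_one_div_add_atTop_nhds_zero_nat
      (Eventually.of_forall fun n => by simp only [Set.mem_Ioi]; positivity)
  have hG₀ : AEStronglyMeasurable G₀ :=
    aestronglyMeasurable_of_tendsto_ae atTop (fun n : ℕ => hmeas (1 / ((n : ℝ) + 1)) (by positivity))
      (hlim.mono fun x hx => hx.comp hseq)
  refine hh.mono' hG₀ ?_
  filter_upwards [hdom, hlim] with x hx hx'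
  refine le_of_tendsto hx'.norm ?_
  filter_upwards [hIoo] with y hy using hx y hy

/-! ### The square root on the closed upper half-plane -/

lemma sqrt_sq (w : ℂ) : Complex.sqrt w ^ 2 = w := by
  have := Complex.cpow_nat_inv_pow w two_ne_zero
  rwa [Nat.cast_ofNat] at this

lemma norm_sqrt (w : ℂ) : ‖Complex.sqrt w‖ = √‖w‖ := by
  rw [← Real.sqrt_sq (norm_nonneg (Complex.sqrt w)), ← norm_pow, sqrt_sq]

/-- The principal root is continuous up to the negative axis from above, because the sign in its
explicit formula is constant for Im z ≥ 0. -/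
lemma continuousOn_sqrt : ContinuousOn Complex.sqrt {z : ℂ | 0 ≤ z.im} := by
  have : ContinuousOn (fun a : ℂ => (√((‖a‖ + a.re) / 2) : ℂ) + √((‖a‖ - a.re) / 2) * Complex.I)
      {z : ℂ | 0 ≤ z.im} := Continuous.continuousOn (by fun_prop)
  refine this.congr fun a ha => ?_
  rw [Complex.sqrt_eq_real_add_ite, if_pos (show 0 ≤ a.im from ha), one_mul]

open ComplexOrder in
lemma sqrt_ofReal_of_nonneg {s : ℝ} (hs : 0 ≤ s) : Complex.sqrt s = √s := by
  rw [Complex.sqrt_of_nonneg (by exact_mod_cast hs), Complex.ofReal_re]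

open ComplexOrder in
lemma sqrt_ofReal_of_nonpos {s : ℝ} (hs : s ≤ 0) : Complex.sqrt s = Complex.I * √(-s) := by
  have h : (0 : ℂ) ≤ ((-s : ℝ) : ℂ) := by exact_mod_cast neg_nonneg.2 hs
  have := Complex.sqrt_neg_of_nonneg h
  rw [sqrt_ofReal_of_nonneg (neg_nonneg.2 hs)] at this
  simpa using this

/-! ### The background root -/

section CutRoot

variable {α β : ℝ}

lemma cutRoot_sq (α β : ℝ) (z : ℂ) : cutRoot α β z ^ 2 = (z - β) ^ 2 - 4 * α ^ 2 := by
  rw [cutRoot, mul_pow, sqrt_sq, sqrt_sq]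
  ring

lemma norm_cutRoot (α β : ℝ) (z : ℂ) :
    ‖cutRoot α β z‖ = √‖z - (β + 2 * α : ℝ)‖ * √‖z - (β - 2 * α : ℝ)‖ := by
  rw [cutRoot, norm_mul, norm_sqrt, norm_sqrt]
  push_cast
  congr 3 <;> ring_nf

lemma differentiableOn_cutRoot (α β : ℝ) : DifferentiableOn ℂ (cutRoot α β) upperHalf := by
  intro z hz
  have hz : 0 < z.im := hz
  have h1 : z - β - 2 * α ∈ Complex.slitPlane := by
    refine Complex.mem_slitPlane_iff.2 (Or.inr ?_)
    simpa using hz.ne'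
  have h2 : z - β + 2 * α ∈ Complex.slitPlane := by
    refine Complex.mem_slitPlane_iff.2 (Or.inr ?_)
    simpa using hz.ne'
  refine DifferentiableAt.differentiableWithinAt ?_
  have d1 : DifferentiableAt ℂ (fun z : ℂ => z - β - 2 * α) z := by fun_prop
  have d2 : DifferentiableAt ℂ (fun z : ℂ => z - β + 2 * α) z := by fun_prop
  exact DifferentiableAt.fun_mul (DifferentiableAt.comp z (Complex.differentiableAt_sqrt h1) d1)
    (DifferentiableAt.comp z (Complex.differentiableAt_sqrt h2) d2)

lemma cutRoot_ne_zero {z : ℂ} (hz : z ∈ upperHalf) : cutRoot α β z ≠ 0 := by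
  have hz : 0 < z.im := hz
  rw [← norm_ne_zero_iff, norm_cutRoot]
  have : ∀ e : ℝ, 0 < √‖z - e‖ := fun e => by
    rw [Real.sqrt_pos, norm_pos_iff]
    intro h0
    have := congrArg Complex.im h0
    simp at this
    exact hz.ne' this
  exact (mul_pos (this _) (this _)).ne'

lemma continuousOn_cutRoot (α β : ℝ) : ContinuousOn (cutRoot α β) {z : ℂ | 0 ≤ z.im} := by
  refine ContinuousOn.mul (continuousOn_sqrt.comp (by fun_prop) fun z hz => ?_)
    (continuousOn_sqrt.comp (by fun_prop) fun z hz => ?_)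
  · simpa using hz
  · simpa using hz

lemma tendsto_cutRoot (α β x : ℝ) :
    Tendsto (cutRoot α β) (𝓝[upperHalf] (x : ℂ)) (𝓝 (cutRoot α β x)) :=
  (continuousOn_cutRoot α β x (by simp)).mono_left (nhdsWithin_mono _ fun z hz => (show 0 < z.im from hz).le)

lemma cutRoot_of_mem_band {x : ℝ} (hx : x ∈ Set.Icc (β - 2 * α) (β + 2 * α)) :
    cutRoot α β x = Complex.I * (√(2 * α + β - x) * √(x - β + 2 * α) : ℝ) := by
  rw [cutRoot, show (x : ℂ) - β - 2 * α = ((x - β - 2 * α : ℝ) : ℂ) by push_cast; ring,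
    show (x : ℂ) - β + 2 * α = ((x - β + 2 * α : ℝ) : ℂ) by push_cast; ring,
    sqrt_ofReal_of_nonpos (by linarith [hx.2]), sqrt_ofReal_of_nonneg (by linarith [hx.1]),
    show -(x - β - 2 * α) = 2 * α + β - x by ring]
  push_cast
  ring

lemma cutRoot_of_gt (hα : 0 < α) {x : ℝ} (hx : β + 2 * α < x) :
    cutRoot α β x = (√(x - β - 2 * α) * √(x - β + 2 * α) : ℝ) := by
  rw [cutRoot, show (x : ℂ) - β - 2 * α = ((x - β - 2 * α : ℝ) : ℂ) by push_cast; ring,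
    show (x : ℂ) - β + 2 * α = ((x - β + 2 * α : ℝ) : ℂ) by push_cast; ring,
    sqrt_ofReal_of_nonneg (by linarith), sqrt_ofReal_of_nonneg (by linarith)]
  push_cast
  ring

lemma cutRoot_of_lt (hα : 0 < α) {x : ℝ} (hx : x < β - 2 * α) :
    cutRoot α β x = (-(√(β + 2 * α - x) * √(β - 2 * α - x)) : ℝ) := by
  rw [cutRoot, show (x : ℂ) - β - 2 * α = ((x - β - 2 * α : ℝ) : ℂ) by push_cast; ring,
    show (x : ℂ) - β + 2 * α = ((x - β + 2 * α : ℝ) : ℂ) by push_cast; ring,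
    sqrt_ofReal_of_nonpos (by linarith), sqrt_ofReal_of_nonpos (by linarith),
    show -(x - β - 2 * α) = β + 2 * α - x by ring, show -(x - β + 2 * α) = β - 2 * α - x by ring]
  push_cast
  linear_combination (√(β + 2 * α - x) * √(β - 2 * α - x) : ℂ) * Complex.I_sq

/-- On its band the root is purely imaginary with positive imaginary part. -/
lemma exists_cutRoot_eq_of_mem_Ioo {x : ℝ} (hx : x ∈ Set.Ioo (β - 2 * α) (β + 2 * α)) :
    ∃ s : ℝ, 0 < s ∧ cutRoot α β x = Complex.I * s := by
  refine ⟨_, mul_pos (Real.sqrt_pos.2 ?_) (Real.sqrt_pos.2 ?_),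
    cutRoot_of_mem_band (Set.Ioo_subset_Icc_self hx)⟩ <;> linarith [hx.1, hx.2]

/-- Off its band the root is real and nonzero on the real line. -/
lemma exists_cutRoot_eq_of_notMem (hα : 0 < α) {x : ℝ}
    (hx : x ∉ Set.Icc (β - 2 * α) (β + 2 * α)) : ∃ s : ℝ, s ≠ 0 ∧ cutRoot α β x = s := by
  rw [Set.mem_Icc, not_and_or, not_le, not_le] at hx
  rcases hx with hx | hx
  · refine ⟨_, ?_, cutRoot_of_lt hα hx⟩
    exact neg_ne_zero.2 (mul_pos (Real.sqrt_pos.2 (by linarith)) (Real.sqrt_pos.2 (by linarith))).ne'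
  · refine ⟨_, ?_, cutRoot_of_gt hα hx⟩
    exact (mul_pos (Real.sqrt_pos.2 (by linarith)) (Real.sqrt_pos.2 (by linarith))).ne'

end CutRoot

open MeasureTheory in
lemma intervalIntegrable_inv_sqrt_abs (p q : ℝ) :
    IntervalIntegrable (fun x : ℝ => (√|x|)⁻¹) volume p q := by
  have hpos : ∀ s : ℝ, 0 ≤ s → IntervalIntegrable (fun x : ℝ => (√|x|)⁻¹) volume 0 s := by
    intro s hs
    refine (intervalIntegral.intervalIntegrable_rpow' (a := 0) (b := s)
      (r := -(1 / 2)) (by norm_num)).congr fun x hx => ?_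
    rw [Set.uIoc_of_le hs] at hx
    rw [abs_of_pos hx.1, Real.rpow_neg hx.1.le, Real.sqrt_eq_rpow]
  have hall : ∀ s : ℝ, IntervalIntegrable (fun x : ℝ => (√|x|)⁻¹) volume 0 s := by
    intro s
    rcases le_total 0 s with hs | hs
    · exact hpos s hs
    · simpa using (hpos (-s) (by linarith)).comp_sub_left 0
  exact (hall p).symm.trans (hall q)

open MeasureTheory in
lemma integrableOn_inv_sqrt_abs_sub (e L : ℝ) :
    IntegrableOn (fun x : ℝ => (√|x - e|)⁻¹) (Set.Ioc (-L) L) := by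
  rcases le_total (-L) L with hL | hL
  · rw [← intervalIntegrable_iff_integrableOn_Ioc_of_le hL]
    simpa using (intervalIntegrable_inv_sqrt_abs (-L - e) (L - e)).comp_sub_right e
  · rw [Set.Ioc_eq_empty (not_lt.2 hL)]
    exact integrableOn_empty

/-- At least one of A, B is not below s. With A, B the distances to the two band edges, this splits
the edge singularities of 1/R into a sum of two integrable ones. -/
lemma inv_mul_sqrt_le {s A B : ℝ} (hs : 0 < s) (hA : 0 < A) (hB : 0 < B) (h : 2 * s ≤ A + B) :
    (√A * √B)⁻¹ ≤ (√s)⁻¹ * ((√A)⁻¹ + (√B)⁻¹) := by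
  have hsA := Real.sqrt_pos.2 hA
  have hsB := Real.sqrt_pos.2 hB
  have hss := Real.sqrt_pos.2 hs
  rcases le_or_gt s B with hsb | hsb
  · calc (√A * √B)⁻¹ = (√B)⁻¹ * (√A)⁻¹ := by rw [mul_inv, mul_comm]
      _ ≤ (√s)⁻¹ * ((√A)⁻¹ + (√B)⁻¹) := by
        gcongr
        linarith [inv_pos.2 hsB]
  · have hsa : s ≤ A := by linarith
    calc (√A * √B)⁻¹ = (√A)⁻¹ * (√B)⁻¹ := by rw [mul_inv]
      _ ≤ (√s)⁻¹ * ((√A)⁻¹ + (√B)⁻¹) := by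
        gcongr
        linarith [inv_pos.2 hsA]

open MeasureTheory in
/-- Integrals of boundary values against the reciprocal of the background root. -/
theorem integral_div_cutRoot_eq_zero {α β : ℝ} (hα : 0 < α) {φ γ : ℂ → ℂ} {φ₀ γ₀ : ℝ → ℂ}
    (hφ : HasBoundaryValues φ φ₀) (hγ : HasBoundaryValues γ γ₀) {K L : ℝ}
    (hφK : ∀ z ∈ upperHalf, L ≤ ‖z‖ → ‖φ z‖ ≤ K / ‖z‖)
    (hγK : ∀ z ∈ upperHalf, L ≤ ‖z‖ → ‖γ z‖ ≤ K) :
    Integrable (fun x : ℝ => φ₀ x * γ₀ x / cutRoot α β x) ∧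
      ∫ x : ℝ, φ₀ x * γ₀ x / cutRoot α β x = 0 := by
  set e₁ : ℝ := β + 2 * α with he₁
  set e₂ : ℝ := β - 2 * α with he₂
  -- Beyond Λ both band edges are at distance at least |z|/2 from z, so that |R(z)| ≥ |z|/2.
  set Λ : ℝ := max L (max 1 (max (2 * |e₁|) (2 * |e₂|))) with hΛ
  have hΛL : L ≤ Λ := le_max_left _ _
  have hΛ1 : 1 ≤ Λ := (le_max_left _ _).trans (le_max_right _ _)
  have hΛe₁ : 2 * |e₁| ≤ Λ :=
    (le_max_left _ _).trans ((le_max_right _ _).trans (le_max_right _ _))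
  have hΛe₂ : 2 * |e₂| ≤ Λ :=
    (le_max_right _ _).trans ((le_max_right _ _).trans (le_max_right _ _))
  have hroot : ∀ z : ℂ, Λ ≤ ‖z‖ → ‖z‖ / 2 ≤ ‖cutRoot α β z‖ := by
    intro z hz
    have h : ∀ e : ℝ, 2 * |e| ≤ Λ → √(‖z‖ / 2) ≤ √‖z - e‖ := fun e he => by
      refine Real.sqrt_le_sqrt ?_
      have := norm_sub_norm_le z e
      rw [Complex.norm_real, Real.norm_eq_abs] at this
      linarith
    rw [norm_cutRoot]
    calc ‖z‖ / 2 = √(‖z‖ / 2) * √(‖z‖ / 2) := (Real.mul_self_sqrt (by positivity)).symm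
      _ ≤ _ := mul_le_mul (h _ hΛe₁) (h _ hΛe₂) (Real.sqrt_nonneg _) (Real.sqrt_nonneg _)
  have hdec : ∀ z ∈ upperHalf, Λ ≤ ‖z‖ →
      ‖φ z * γ z / cutRoot α β z‖ ≤ (2 * K ^ 2) / ‖z‖ ^ 2 := by
    intro z hz hzΛ
    have hz0 : 0 < ‖z‖ := by linarith
    have h1 := hφK z hz (hΛL.trans hzΛ)
    have h2 := hγK z hz (hΛL.trans hzΛ)
    have h3 := hroot z hzΛ
    have hK : 0 ≤ K := (norm_nonneg _).trans h2
    rw [norm_div, norm_mul]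
    calc ‖φ z‖ * ‖γ z‖ / ‖cutRoot α β z‖ ≤ K / ‖z‖ * K / (‖z‖ / 2) := by gcongr
      _ = 2 * K ^ 2 / ‖z‖ ^ 2 := by field_simp
  obtain ⟨M₁, hM₁⟩ := hφ.exists_bound 0 (Λ + 1)
  obtain ⟨M₂, hM₂⟩ := hγ.exists_bound 0 (Λ + 1)
  have hM₁0 : 0 ≤ M₁ := (norm_nonneg _).trans (hM₁ 0 (by simp) (by simp; linarith))
  have hM₂0 : 0 ≤ M₂ := (norm_nonneg _).trans (hM₂ 0 (by simp) (by simp; linarith))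
  -- Dominating function: inverse square roots at the edges on a bounded interval, plus a
  -- quadratically decaying tail that absorbs 2K²/|z|².
  let h : ℝ → ℝ := fun x =>
    (Set.Ioc (-Λ) Λ).indicator
      (fun x => M₁ * M₂ * ((√(2 * α))⁻¹ * ((√|x - e₁|)⁻¹ + (√|x - e₂|)⁻¹))) x +
      4 * K ^ 2 * (1 + x ^ 2)⁻¹
  have hind : ∀ x, 0 ≤ (Set.Ioc (-Λ) Λ).indicator
      (fun x => M₁ * M₂ * ((√(2 * α))⁻¹ * ((√|x - e₁|)⁻¹ + (√|x - e₂|)⁻¹))) x := fun x =>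
    Set.indicator_nonneg (fun x _ => by positivity) x
  have hh : Integrable h := by
    refine Integrable.add ?_ (integrable_inv_one_add_sq.const_mul _)
    rw [integrable_indicator_iff measurableSet_Ioc]
    exact (((integrableOn_inv_sqrt_abs_sub e₁ Λ).add
      (integrableOn_inv_sqrt_abs_sub e₂ Λ)).const_mul _).const_mul _
  have hae : ∀ᵐ x : ℝ, x ≠ e₁ ∧ x ≠ e₂ :=
    (Measure.ae_ne volume e₁).and (Measure.ae_ne volume e₂)
  refine integral_boundary_eq_zero (G := fun z => φ z * γ z / cutRoot α β z) (h := h)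
    ((hφ.differentiableOn.mul hγ.differentiableOn).div (differentiableOn_cutRoot α β)
      fun z hz => cutRoot_ne_zero hz) hdec hh ?_ ?_
  · filter_upwards [hae] with x hx y hy
    set z : ℂ := x + y * Complex.I with hz
    have hre : z.re = x := by simp [hz]
    have him : z.im = y := by simp [hz]
    have hzU : z ∈ upperHalf := by simpa only [upperHalf, Set.mem_ofPred_eq, him] using hy.1
    rcases le_or_gt |x| Λ with hxΛ | hxΛ
    · rcases eq_or_ne x (-Λ) with hxe | hxe
      · have hzx : |x| ≤ ‖z‖ := hre ▸ Complex.abs_re_le_norm z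
        have hx1 : |x| = Λ := by rw [hxe, abs_neg, abs_of_pos (by linarith)]
        refine (hdec z hzU (hx1 ▸ hzx)).trans ?_
        have hx2 : 1 + x ^ 2 ≤ 2 * ‖z‖ ^ 2 := by
          nlinarith [sq_abs x, abs_nonneg x]
        calc 2 * K ^ 2 / ‖z‖ ^ 2 = 4 * K ^ 2 * (2 * ‖z‖ ^ 2)⁻¹ := by
              rw [mul_inv]; ring
          _ ≤ 4 * K ^ 2 * (1 + x ^ 2)⁻¹ := by gcongr
          _ ≤ h x := by simp only [h]; linarith [hind x]
      · have hmem : x ∈ Set.Ioc (-Λ) Λ :=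
          ⟨lt_of_le_of_ne (abs_le.1 hxΛ).1 (Ne.symm hxe), (abs_le.1 hxΛ).2⟩
        have hzn : ‖z - 0‖ ≤ Λ + 1 := by
          rw [sub_zero]
          refine (Complex.norm_le_abs_re_add_abs_im z).trans ?_
          rw [hre, him, abs_of_pos hy.1]
          linarith [hy.2]
        have h1 := hM₁ z (by rw [him]; exact hy.1.le) hzn
        have h2 := hM₂ z (by rw [him]; exact hy.1.le) hzn
        rw [hφ.extendFrom_of_mem hzU] at h1
        rw [hγ.extendFrom_of_mem hzU] at h2
        have hsub : ∀ e : ℝ, |x - e| ≤ ‖z - e‖ := fun e => by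
          have := Complex.abs_re_le_norm (z - e)
          rwa [Complex.sub_re, hre, Complex.ofReal_re] at this
        have hp₁ : 0 < |x - e₁| := abs_pos.2 (sub_ne_zero.2 hx.1)
        have hp₂ : 0 < |x - e₂| := abs_pos.2 (sub_ne_zero.2 hx.2)
        have h3 : √|x - e₁| * √|x - e₂| ≤ ‖cutRoot α β z‖ := by
          rw [norm_cutRoot]
          gcongr
          · exact hsub _
          · exact hsub _
        have hpp : 0 < √|x - e₁| * √|x - e₂| :=
          mul_pos (Real.sqrt_pos.2 hp₁) (Real.sqrt_pos.2 hp₂)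
        have h4 : 2 * (2 * α) ≤ |x - e₁| + |x - e₂| := by
          have := abs_sub (x - e₂) (x - e₁)
          have h5 : (x - e₂) - (x - e₁) = 4 * α := by rw [he₁, he₂]; ring
          rw [h5, abs_of_pos (by linarith)] at this
          linarith
        rw [norm_div, norm_mul]
        calc ‖φ z‖ * ‖γ z‖ / ‖cutRoot α β z‖
            ≤ M₁ * M₂ / (√|x - e₁| * √|x - e₂|) := by gcongr
          _ = M₁ * M₂ * (√|x - e₁| * √|x - e₂|)⁻¹ := div_eq_mul_inv _ _
          _ ≤ M₁ * M₂ * ((√(2 * α))⁻¹ * ((√|x - e₁|)⁻¹ + (√|x - e₂|)⁻¹)) := by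
              gcongr
              exact inv_mul_sqrt_le (by linarith) hp₁ hp₂ h4
          _ ≤ h x := by
              simp only [h, Set.indicator_of_mem hmem]
              have : 0 ≤ 4 * K ^ 2 * (1 + x ^ 2)⁻¹ := by positivity
              linarith
    · have hzx : |x| ≤ ‖z‖ := hre ▸ Complex.abs_re_le_norm z
      refine (hdec z hzU (hxΛ.le.trans hzx)).trans ?_
      have hx2 : 1 + x ^ 2 ≤ 2 * ‖z‖ ^ 2 := by
        nlinarith [sq_abs x, abs_nonneg x]
      calc 2 * K ^ 2 / ‖z‖ ^ 2 = 4 * K ^ 2 * (2 * ‖z‖ ^ 2)⁻¹ := by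
            rw [mul_inv]; ring
        _ ≤ 4 * K ^ 2 * (1 + x ^ 2)⁻¹ := by gcongr
        _ ≤ h x := by simp only [h]; linarith [hind x]
  · filter_upwards [hae] with x hx
    have hne : cutRoot α β x ≠ 0 := by
      rw [← norm_ne_zero_iff, norm_cutRoot]
      have : ∀ e : ℝ, x ≠ e → 0 < √‖(x : ℂ) - e‖ := fun e he => by
        rw [Real.sqrt_pos, norm_pos_iff, sub_ne_zero]
        exact_mod_cast he
      exact (mul_pos (this _ hx.1) (this _ hx.2)).ne'
    exact (((hφ.tendsto x).mul (hγ.tendsto x)).div (tendsto_cutRoot α β x) hne).comp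
      (tendsto_vertical x)

/-! ### The vanishing argument on the upper half-plane -/

open MeasureTheory in
/-- Two pairs of holomorphic functions on the upper half-plane, linked by the jump relations on an
interval where the root is imaginary and another one where it is real, vanish identically. -/
theorem eq_zero_of_jump_relations {α β p q : ℝ} (hα : 0 < α) (hpq : p < q)
    (hdisj : ∀ x ∈ Set.Icc p q, x ∉ Set.Icc (β - 2 * α) (β + 2 * α))
    {f g f' g' : ℂ → ℂ} {fu gu fd gd : ℝ → ℂ}
    (hf : HasBoundaryValues f fu) (hg : HasBoundaryValues g gu)
    (hf' : HasBoundaryValues f' fun x => conj (fd x))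
    (hg' : HasBoundaryValues g' fun x => conj (gd x)) {K L : ℝ}
    (hfK : ∀ z ∈ upperHalf, L ≤ ‖z‖ → ‖f z‖ ≤ K / ‖z‖)
    (hgK : ∀ z ∈ upperHalf, L ≤ ‖z‖ → ‖g z‖ ≤ K)
    (hfK' : ∀ z ∈ upperHalf, L ≤ ‖z‖ → ‖f' z‖ ≤ K / ‖z‖)
    (hgK' : ∀ z ∈ upperHalf, L ≤ ‖z‖ → ‖g' z‖ ≤ K)
    (hoff : ∀ x, x ∉ Set.Icc (β - 2 * α) (β + 2 * α) → x ∉ Set.Icc p q →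
      fu x = fd x ∧ gu x = gd x)
    (hown : ∀ x ∈ Set.Ioo (β - 2 * α) (β + 2 * α), ∃ ρ : ℂ, ‖ρ‖ = 1 ∧
      fu x = ρ * fd x ∧ gu x = fd x - conj ρ * gd x)
    (hcross : ∀ x ∈ Set.Ioo p q, ∃ κ : ℝ, 0 < κ ∧
      fu x = fd x - Complex.I * κ * cutRoot α β x * gd x ∧ gu x = gd x) :
    ∀ z ∈ upperHalf, f z = 0 ∧ g z = 0 ∧ f' z = 0 ∧ g' z = 0 := by
  obtain ⟨i1, z1⟩ := integral_div_cutRoot_eq_zero (β := β) hα hf hg' hfK hgK'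
  obtain ⟨i2, z2⟩ := integral_div_cutRoot_eq_zero (β := β) hα hf' hg hfK' hgK
  -- The conjugation aligns the mixed products of fd and gd. They cancel on both bands since R is
  -- imaginary on the own band and real on the other, leaving only squares of moduli.
  let D : ℝ → ℂ := fun x => Complex.I * (fu x * conj (gd x) / cutRoot α β x -
    conj (conj (fd x) * gu x / cutRoot α β x))
  have i2' : Integrable fun x : ℝ => conj (conj (fd x) * gu x / cutRoot α β x) :=
    (LinearIsometryEquiv.integrable_comp_iff Complex.conjLIE).2 i2
  have hDi : Integrable D := (i1.sub i2').const_mul _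
  have hD0 : ∫ x, D x = 0 := by
    simp only [D]
    rw [integral_const_mul, integral_sub i1 i2', z1, integral_conj, z2]
    simp
  have hDown : ∀ x ∈ Set.Ioo (β - 2 * α) (β + 2 * α),
      ∃ s : ℝ, 0 < s ∧ D x = ((‖fd x‖ ^ 2 / s : ℝ) : ℂ) := by
    intro x hx
    obtain ⟨ρ, hρ, h1, h2⟩ := hown x hx
    obtain ⟨s, hs, hR⟩ := exists_cutRoot_eq_of_mem_Ioo hx
    refine ⟨s, hs, ?_⟩
    have hs' : (s : ℂ) ≠ 0 := by exact_mod_cast hs.ne'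
    simp only [D, hR, h1, h2, map_div₀, map_mul, map_sub, Complex.conj_conj, Complex.conj_I,
      Complex.conj_ofReal]
    push_cast
    rw [← Complex.mul_conj']
    field_simp
    ring
  have hDcross : ∀ x ∈ Set.Ioo p q, ∃ κ : ℝ, 0 < κ ∧ D x = ((κ * ‖gd x‖ ^ 2 : ℝ) : ℂ) := by
    intro x hx
    obtain ⟨κ, hκ, h1, h2⟩ := hcross x hx
    obtain ⟨s, hs, hR⟩ := exists_cutRoot_eq_of_notMem hα
      (hdisj x (Set.Ioo_subset_Icc_self hx))
    refine ⟨κ, hκ, ?_⟩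
    have hs' : (s : ℂ) ≠ 0 := by exact_mod_cast hs
    simp only [D, hR, h1, h2, map_div₀, map_mul, Complex.conj_conj, Complex.conj_ofReal]
    push_cast
    rw [← Complex.mul_conj']
    field_simp
    linear_combination (-κ * s * gd x * conj (gd x)) * Complex.I_sq
  have hDoff : ∀ x, x ∉ Set.Icc (β - 2 * α) (β + 2 * α) → x ∉ Set.Icc p q → D x = 0 := by
    intro x hx hx'
    obtain ⟨h1, h2⟩ := hoff x hx hx'
    obtain ⟨s, hs, hR⟩ := exists_cutRoot_eq_of_notMem hα hx
    simp only [D, hR, h1, h2, map_div₀, map_mul, Complex.conj_conj, Complex.conj_ofReal]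
    ring
  have hae : ∀ᵐ x : ℝ, x ≠ β - 2 * α ∧ x ≠ β + 2 * α ∧ x ≠ p ∧ x ≠ q :=
    (Measure.ae_ne volume _).and ((Measure.ae_ne volume _).and
      ((Measure.ae_ne volume _).and (Measure.ae_ne volume _)))
  have hDpos : ∀ᵐ x : ℝ, D x = ((D x).re : ℂ) ∧ 0 ≤ (D x).re := by
    filter_upwards [hae] with x hx
    obtain ⟨hx1, hx2, hx3, hx4⟩ := hx
    by_cases hb : x ∈ Set.Icc (β - 2 * α) (β + 2 * α)
    · obtain ⟨s, hs, h⟩ := hDown x ⟨lt_of_le_of_ne hb.1 hx1.symm, lt_of_le_of_ne hb.2 hx2⟩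
      rw [h, Complex.ofReal_re]
      exact ⟨rfl, by positivity⟩
    · by_cases hc : x ∈ Set.Icc p q
      · obtain ⟨κ, hκ, h⟩ := hDcross x ⟨lt_of_le_of_ne hc.1 hx3.symm, lt_of_le_of_ne hc.2 hx4⟩
        rw [h, Complex.ofReal_re]
        exact ⟨rfl, by positivity⟩
      · simp [hDoff x hb hc]
  have hDae : ∀ᵐ x : ℝ, D x = 0 := by
    have hre : ∫ x, (D x).re = 0 := by
      have := integral_re hDi
      simpa [hD0] using this
    have := (integral_eq_zero_iff_of_nonneg_ae (hDpos.mono fun x hx => hx.2) hDi.re).1 hre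
    filter_upwards [hDpos, this] with x hx hx'
    rw [hx.1, hx']
    simp
  -- Vanishing almost everywhere becomes vanishing everywhere because boundary values are
  -- continuous.
  have hfd0 : Set.EqOn (fun x => conj (fd x)) (fun _ => 0)
      (Set.Ioo (β - 2 * α) (β + 2 * α)) := by
    refine Measure.eqOn_open_of_ae_eq (μ := volume) ?_ isOpen_Ioo hf'.continuous.continuousOn
      continuousOn_const
    rw [EventuallyEq, ae_restrict_iff' measurableSet_Ioo]
    filter_upwards [hDae] with x hx hmem
    obtain ⟨s, hs, h⟩ := hDown x hmem
    rw [h, Complex.ofReal_eq_zero, div_eq_zero_iff, or_iff_left hs.ne'] at hx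
    simpa using hx
  have hgd0 : Set.EqOn (fun x => conj (gd x)) (fun _ => 0) (Set.Ioo p q) := by
    refine Measure.eqOn_open_of_ae_eq (μ := volume) ?_ isOpen_Ioo hg'.continuous.continuousOn
      continuousOn_const
    rw [EventuallyEq, ae_restrict_iff' measurableSet_Ioo]
    filter_upwards [hDae] with x hx hmem
    obtain ⟨κ, hκ, h⟩ := hDcross x hmem
    rw [h, Complex.ofReal_eq_zero, mul_eq_zero, or_iff_right hκ.ne'] at hx
    simpa using hx
  have hlt : β - 2 * α < β + 2 * α := by linarith
  have hfu0 : ∀ x ∈ Set.Ioo (β - 2 * α) (β + 2 * α), fu x = 0 := fun x hx => by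
    obtain ⟨ρ, -, h1, -⟩ := hown x hx
    have : fd x = 0 := by simpa using hfd0 hx
    rw [h1, this, mul_zero]
  have hgu0 : ∀ x ∈ Set.Ioo p q, gu x = 0 := fun x hx => by
    obtain ⟨κ, -, -, h2⟩ := hcross x hx
    rw [h2]
    simpa using hgd0 hx
  exact fun z hz => ⟨hf.eq_zero_of_boundary hlt hfu0 z hz, hg.eq_zero_of_boundary hpq hgu0 z hz,
    hf'.eq_zero_of_boundary hlt hfd0 z hz, hg'.eq_zero_of_boundary hpq hgd0 z hz⟩

/-! ### Pre-solutions of the Riemann--Hilbert problem -/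

lemma isClosed_cuts (c d : ℝ) : IsClosed (cuts c d) := by
  refine IsCompact.isClosed (IsCompact.image ?_ Complex.continuous_ofReal)
  exact isCompact_Icc.union isCompact_Icc

lemma notMem_cuts_of_im_ne_zero {c d : ℝ} {z : ℂ} (hz : z.im ≠ 0) : z ∉ cuts c d := by
  rintro ⟨x, -, rfl⟩
  simp at hz

lemma ofReal_mem_cuts {c d x : ℝ} : (x : ℂ) ∈ cuts c d ↔ x ∈ bandOne c d ∪ bandTwo := by
  constructor
  · rintro ⟨y, hy, hyx⟩
    rwa [← Complex.ofReal_injective hyx]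
  · exact fun hx => ⟨x, hx, rfl⟩

lemma coe_mem_offContour {c d : ℝ} {s : Sheet} {z : ℂ} :
    ((s, (z : OnePoint ℂ)) : SurfPt) ∈ offContour c d ↔ z ∉ cuts c d := by
  simp only [offContour, Set.mem_ofPred_eq]
  rw [not_iff_not, Function.Injective.mem_set_image OnePoint.coe_injective]

lemma infty_mem_offContour {c d : ℝ} {s : Sheet} :
    ((s, OnePoint.infty) : SurfPt) ∈ offContour c d := by
  rintro ⟨z, -, h⟩
  exact OnePoint.coe_ne_infty z h

lemma inftyChart_zero : inftyChart 0 = OnePoint.infty := if_pos rfl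

lemma inftyChart_inv {z : ℂ} (hz : z ≠ 0) : inftyChart z⁻¹ = (z : OnePoint ℂ) := by
  rw [inftyChart, if_neg (inv_ne_zero hz), inv_inv]

/-- The open lower half-plane. -/
def lowerHalf : Set ℂ := {z : ℂ | z.im < 0}

/-- At a branch point the approach filter is that of the whole slit neighbourhood. Restricting it to
a half-plane lets edges and interior points be treated alike. -/
lemma nhdsWithin_upperHalf_le_approach (c d x : ℝ) :
    𝓝[upperHalf] (x : ℂ) ≤ approach c d x .up := by
  rw [approach]
  split_ifs
  · exact nhdsWithin_mono _ fun z hz => notMem_cuts_of_im_ne_zero (ne_of_gt hz)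
  · exact le_rfl

lemma nhdsWithin_lowerHalf_le_approach (c d x : ℝ) :
    𝓝[lowerHalf] (x : ℂ) ≤ approach c d x .down := by
  rw [approach]
  split_ifs
  · exact nhdsWithin_mono _ fun z hz => notMem_cuts_of_im_ne_zero (ne_of_lt hz)
  · exact le_rfl

lemma vecMul_swap (u : Fin 2 → ℂ) : u ᵥ* !![0, 1; 1, 0] = ![u 1, u 0] := by
  ext i
  fin_cases i <;> simp [Matrix.vecMul, dotProduct, Fin.sum_univ_two]

namespace IsPreSolution

variable {c d : ℝ} {v : ℝ → Side → Matrix (Fin 2) (Fin 2) ℂ} {m m' : SurfPt → Fin 2 → ℂ}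

lemma lower_eq (h : IsPreSolution c d v m) {z : OnePoint ℂ}
    (hz : ((Sheet.upper, z) : SurfPt) ∈ offContour c d) :
    m (.lower, z) = ![m (.upper, z) 1, m (.upper, z) 0] := by
  rw [← vecMul_swap, ← h.symmetry _ hz]
  rfl

lemma continuousAt_upper (h : IsPreSolution c d v m) {z : ℂ} (hz : z ∉ cuts c d) :
    ContinuousAt (fun z : ℂ => m (.upper, (z : OnePoint ℂ))) z :=
  ((h.holomorphic .upper).1.differentiableAt
    ((isClosed_cuts c d).isOpen_compl.mem_nhds hz)).continuousAt

/-- Boundary values of a pre-solution on the upper sheet from both half-planes. -/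
lemma exists_boundary (h : IsPreSolution c d v m) : ∃ mu md : ℝ → Fin 2 → ℂ,
    (∀ x : ℝ, Tendsto (fun z : ℂ => m (.upper, (z : OnePoint ℂ))) (𝓝[upperHalf] (x : ℂ))
      (𝓝 (mu x))) ∧
    (∀ x : ℝ, Tendsto (fun z : ℂ => m (.upper, (z : OnePoint ℂ))) (𝓝[lowerHalf] (x : ℂ))
      (𝓝 (md x))) ∧
    (∀ x ∉ bandOne c d ∪ bandTwo, mu x = md x) ∧
    ∀ x ∈ bandOne c d ∪ bandTwo, mu x = ![md x 1, md x 0] ᵥ* v x .up := by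
  have key : ∀ x : ℝ, ∃ p : (Fin 2 → ℂ) × (Fin 2 → ℂ),
      Tendsto (fun z : ℂ => m (.upper, (z : OnePoint ℂ))) (𝓝[upperHalf] (x : ℂ)) (𝓝 p.1) ∧
      Tendsto (fun z : ℂ => m (.upper, (z : OnePoint ℂ))) (𝓝[lowerHalf] (x : ℂ)) (𝓝 p.2) ∧
      (x ∉ bandOne c d ∪ bandTwo → p.1 = p.2) ∧
      (x ∈ bandOne c d ∪ bandTwo → p.1 = ![p.2 1, p.2 0] ᵥ* v x .up) := by
    intro x
    by_cases hx : x ∈ bandOne c d ∪ bandTwo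
    -- By the crosswise gluing, m₋ at x + i0 is a limit on the lower sheet from the lower
    -- half-plane. Symmetry turns it into the swapped limit on the upper sheet, so the jumps at the
    -- `.up` points suffice.
    · obtain ⟨mp, mm, h1, h2, h3⟩ := h.jump x hx .up
      refine ⟨(mp, ![mm 1, mm 0]), h1.mono_left (nhdsWithin_upperHalf_le_approach c d x), ?_,
        fun h => absurd hx h, fun _ => ?_⟩
      · have h2' : Tendsto (fun z : ℂ => m (.lower, (z : OnePoint ℂ))) (𝓝[lowerHalf] (x : ℂ))
            (𝓝 mm) := h2.mono_left (nhdsWithin_lowerHalf_le_approach c d x)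
        have hsw : Continuous fun u : Fin 2 → ℂ => ![u 1, u 0] := by
          refine continuous_pi fun i => ?_
          fin_cases i
          · exact continuous_apply 1
          · exact continuous_apply 0
        refine ((hsw.tendsto mm).comp h2').congr' ?_
        filter_upwards [self_mem_nhdsWithin] with z hz
        have hz' : z ∉ cuts c d := notMem_cuts_of_im_ne_zero (ne_of_lt hz)
        simp only [Function.comp_apply]
        rw [h.lower_eq (coe_mem_offContour.2 hz')]
        ext i
        fin_cases i <;> rfl
      · have : (![![mm 1, mm 0] 1, ![mm 1, mm 0] 0] : Fin 2 → ℂ) = mm := by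
          ext i
          fin_cases i <;> rfl
        rw [this]
        exact h3
    · have hc := h.continuousAt_upper (fun hmem => hx (ofReal_mem_cuts.1 hmem))
      exact ⟨(_, _), hc.mono_left nhdsWithin_le_nhds, hc.mono_left nhdsWithin_le_nhds,
        fun _ => rfl, fun h => absurd h hx⟩
  choose p hp using key
  exact ⟨fun x => (p x).1, fun x => (p x).2, fun x => (hp x).1, fun x => (hp x).2.1,
    fun x => (hp x).2.2.1, fun x => (hp x).2.2.2⟩

lemma tendsto_infty (h : IsPreSolution c d v m) :
    Tendsto (fun z : ℂ => m (.upper, (z : OnePoint ℂ))) (cocompact ℂ)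
      (𝓝 (m (.upper, OnePoint.infty))) := by
  have hc := (h.holomorphic .upper).2.continuousAt.tendsto
  rw [inftyChart_zero] at hc
  have hinv : Tendsto (fun z : ℂ => z⁻¹) (cocompact ℂ) (𝓝 0) := by
    rw [← Metric.cobounded_eq_cocompact]
    exact tendsto_inv₀_cobounded
  refine (hc.comp hinv).congr' ?_
  have : ({0} : Set ℂ)ᶜ ∈ cocompact ℂ := isCompact_singleton.compl_mem_cocompact
  filter_upwards [this] with z hz
  simp only [Function.comp_apply]
  rw [inftyChart_inv hz]

/-- Differentiability in the local parameter 1/λ makes the deviation from the value at ∞₊ of order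
1/|λ|. -/
lemma exists_growth (h : IsPreSolution c d v m) (h0 : m (.upper, OnePoint.infty) 0 = 0) :
    ∃ K L : ℝ, ∀ z : ℂ, L ≤ ‖z‖ → ‖m (.upper, (z : OnePoint ℂ)) 0‖ ≤ K / ‖z‖ ∧
      ‖m (.upper, (z : OnePoint ℂ)) 1‖ ≤ K := by
  have hd := (h.holomorphic .upper).2
  obtain ⟨C, hC⟩ := hd.isBigO_sub.bound
  obtain ⟨δ, hδ, hball⟩ := Metric.eventually_nhds_iff.1 hC
  have hC' : ∀ w : ℂ, ‖w‖ < δ → ∀ i, ‖m (.upper, inftyChart w) i - m (.upper, OnePoint.infty) i‖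
      ≤ |C| * ‖w‖ := by
    intro w hw i
    have := hball (y := w) (by simpa using hw)
    rw [inftyChart_zero, sub_zero] at this
    calc _ ≤ ‖m (.upper, inftyChart w) - m (.upper, OnePoint.infty)‖ :=
          norm_le_pi_norm (m (.upper, inftyChart w) - m (.upper, OnePoint.infty)) i
      _ ≤ C * ‖w‖ := this
      _ ≤ |C| * ‖w‖ := by gcongr; exact le_abs_self C
  refine ⟨|C| * (1 + δ) + ‖m (.upper, OnePoint.infty) 1‖, 2 / δ, fun z hz => ?_⟩
  have hz0 : 0 < ‖z‖ := lt_of_lt_of_le (by positivity) hz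
  have hw : ‖z⁻¹‖ < δ := by
    rw [norm_inv, inv_lt_comm₀ hz0 hδ]
    refine lt_of_lt_of_le ?_ hz
    rw [div_eq_mul_inv]
    linarith [inv_pos.2 hδ]
  have h1 := hC' _ hw
  rw [inftyChart_inv (norm_pos_iff.1 hz0)] at h1
  constructor
  · have := h1 0
    rw [h0, sub_zero, norm_inv, ← div_eq_mul_inv] at this
    refine this.trans ?_
    gcongr
    have : 0 ≤ |C| * δ := by positivity
    linarith [norm_nonneg (m (.upper, OnePoint.infty) 1)]
  · have h2 := h1 1
    have h3 : |C| * ‖z⁻¹‖ ≤ |C| * δ := by gcongr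
    have h4 := norm_le_norm_add_norm_sub' (m (.upper, (z : OnePoint ℂ)) 1)
      (m (.upper, OnePoint.infty) 1)
    have := abs_nonneg C
    linarith

lemma hasBoundaryValues (h : IsPreSolution c d v m) {mu : ℝ → Fin 2 → ℂ}
    (hmu : ∀ x : ℝ, Tendsto (fun z : ℂ => m (.upper, (z : OnePoint ℂ))) (𝓝[upperHalf] (x : ℂ))
      (𝓝 (mu x))) (i : Fin 2) :
    HasBoundaryValues (fun z => m (.upper, (z : OnePoint ℂ)) i) fun x => mu x i := by
  refine ⟨?_, fun x => tendsto_pi_nhds.1 (hmu x) i⟩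
  exact (differentiableOn_pi.1 (h.holomorphic .upper).1 i).mono
    fun z hz => notMem_cuts_of_im_ne_zero (ne_of_gt hz)

/-- Schwarz reflection moves the lower half-plane to the upper one, so both families of limits are
boundary values there. -/
lemma hasBoundaryValues_conj (h : IsPreSolution c d v m) {md : ℝ → Fin 2 → ℂ}
    (hmd : ∀ x : ℝ, Tendsto (fun z : ℂ => m (.upper, (z : OnePoint ℂ))) (𝓝[lowerHalf] (x : ℂ))
      (𝓝 (md x))) (i : Fin 2) :
    HasBoundaryValues (fun z => conj (m (.upper, ((conj z : ℂ) : OnePoint ℂ)) i))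
      fun x => conj (md x i) := by
  refine ⟨fun z hz => ?_, fun x => ?_⟩
  · have hz' : conj z ∉ cuts c d :=
      notMem_cuts_of_im_ne_zero (by rw [Complex.conj_im]; exact neg_ne_zero.2 (ne_of_gt hz))
    have := (differentiableOn_pi.1 (h.holomorphic .upper).1 i).differentiableAt
      ((isClosed_cuts c d).isOpen_compl.mem_nhds hz')
    have h2 := this.conj_conj
    rw [Complex.conj_conj] at h2
    exact h2.differentiableWithinAt
  · have hconj : Tendsto (fun z : ℂ => conj z) (𝓝[upperHalf] (x : ℂ)) (𝓝[lowerHalf] (x : ℂ)) := by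
      refine tendsto_nhdsWithin_of_tendsto_nhds_of_eventually_within _ ?_ ?_
      · have := (Complex.continuous_conj.tendsto (x : ℂ)).mono_left
          (nhdsWithin_le_nhds (s := upperHalf))
        rwa [Complex.conj_ofReal] at this
      · filter_upwards [self_mem_nhdsWithin] with z hz
        have hz : 0 < z.im := hz
        simpa [lowerHalf] using hz
    exact (Complex.continuous_conj.tendsto _).comp
      ((tendsto_pi_nhds.1 (hmd x) i).comp hconj)

/-- A pre-solution whose components on the upper sheet vanish off the real line is zero. -/
lemma eq_zero_of_im_ne_zero (h : IsPreSolution c d v m)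
    (h0 : ∀ z : ℂ, z.im ≠ 0 → m (.upper, (z : OnePoint ℂ)) = 0) :
    ∀ p ∈ offContour c d, m p = 0 := by
  have hup : ∀ z : OnePoint ℂ, ((Sheet.upper, z) : SurfPt) ∈ offContour c d →
      m (.upper, z) = 0 := by
    intro z hz
    induction z using OnePoint.rec with
    | infty =>
      have hI : Tendsto (fun y : ℝ => (y : ℂ) * Complex.I) atTop (cocompact ℂ) := by
        rw [← Metric.cobounded_eq_cocompact, ← tendsto_norm_atTop_iff_cobounded]
        simpa using tendsto_abs_atTop_atTop
      have h1 := h.tendsto_infty.comp hI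
      refine tendsto_nhds_unique h1 (tendsto_const_nhds.congr' ?_)
      filter_upwards [eventually_gt_atTop 0] with y hy
      exact (h0 _ (by simpa using hy.ne')).symm
    | coe z =>
      by_cases him : z.im = 0
      · obtain ⟨x, rfl⟩ : ∃ x : ℝ, z = x := ⟨z.re, Complex.ext rfl (by simp [him])⟩
        have hc := h.continuousAt_upper (coe_mem_offContour.1 hz)
        refine tendsto_nhds_unique (hc.mono_left (nhdsWithin_le_nhds (s := upperHalf)))
          (tendsto_const_nhds.congr' ?_)
        filter_upwards [self_mem_nhdsWithin] with w hw
        exact (h0 w (ne_of_gt hw)).symm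
      · exact h0 z him
  rintro ⟨s, z⟩ hz
  cases s
  · exact hup z hz
  · have hz' : ((Sheet.upper, z) : SurfPt) ∈ offContour c d := hz
    rw [h.lower_eq hz', hup z hz']
    ext i
    fin_cases i <;> rfl

/-- Vanishing of pre-solutions for jump matrices of the form occurring in the left and in the right
problem. -/
theorem eq_zero_of_jump_form {α β p q : ℝ} (hα : 0 < α) (hpq : p < q)
    (hdisj : ∀ x ∈ Set.Icc p q, x ∉ Set.Icc (β - 2 * α) (β + 2 * α))
    (hbands : bandOne c d ∪ bandTwo = Set.Icc (β - 2 * α) (β + 2 * α) ∪ Set.Icc p q)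
    (hown : ∀ x ∈ Set.Ioo (β - 2 * α) (β + 2 * α), ∃ ρ : ℂ, ‖ρ‖ = 1 ∧
      v x .up = !![0, -conj ρ; ρ, 1])
    (hcross : ∀ x ∈ Set.Ioo p q, ∃ κ : ℝ, 0 < κ ∧
      v x .up = !![-(Complex.I * κ * cutRoot α β x), 1; 1, 0])
    (h : IsPreSolution c d v m) (h0 : m (.upper, OnePoint.infty) 0 = 0) :
    ∀ p ∈ offContour c d, m p = 0 := by
  obtain ⟨mu, md, hmu, hmd, hoff, hon⟩ := h.exists_boundary
  obtain ⟨K, L, hKL⟩ := h.exists_growth h0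
  have hKL' : ∀ z : ℂ, L ≤ ‖z‖ → ‖conj (m (.upper, ((conj z : ℂ) : OnePoint ℂ)) 0)‖ ≤ K / ‖z‖ ∧
      ‖conj (m (.upper, ((conj z : ℂ) : OnePoint ℂ)) 1)‖ ≤ K := by
    intro z hz
    have := hKL (conj z) (by rwa [Complex.norm_conj])
    simpa only [Complex.norm_conj] using this
  have key := eq_zero_of_jump_relations (β := β) hα hpq hdisj
    (h.hasBoundaryValues hmu 0) (h.hasBoundaryValues hmu 1)
    (h.hasBoundaryValues_conj hmd 0) (h.hasBoundaryValues_conj hmd 1)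
    (fun z _ hz => (hKL z hz).1) (fun z _ hz => (hKL z hz).2)
    (fun z _ hz => (hKL' z hz).1) (fun z _ hz => (hKL' z hz).2)
    (fun x hx hx' => by
      have hx2 : x ∉ bandOne c d ∪ bandTwo := by
        rw [hbands]
        exact fun hmem => hmem.elim hx hx'
      rw [hoff x hx2]
      exact ⟨rfl, rfl⟩)
    (fun x hx => by
      obtain ⟨ρ, hρ, hv⟩ := hown x hx
      have hx2 : x ∈ bandOne c d ∪ bandTwo := by
        rw [hbands]
        exact Or.inl (Set.Ioo_subset_Icc_self hx)
      have := hon x hx2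
      rw [hv] at this
      refine ⟨ρ, hρ, ?_, ?_⟩
      · rw [this]
        simp [Matrix.vecMul, dotProduct, Fin.sum_univ_two]
        ring
      · rw [this]
        simp [Matrix.vecMul, dotProduct, Fin.sum_univ_two]
        ring)
    (fun x hx => by
      obtain ⟨κ, hκ, hv⟩ := hcross x hx
      have hx2 : x ∈ bandOne c d ∪ bandTwo := by
        rw [hbands]
        exact Or.inr (Set.Ioo_subset_Icc_self hx)
      have := hon x hx2
      rw [hv] at this
      refine ⟨κ, hκ, ?_, ?_⟩
      · rw [this]
        simp [Matrix.vecMul, dotProduct, Fin.sum_univ_two]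
        ring
      · rw [this]
        simp [Matrix.vecMul, dotProduct, Fin.sum_univ_two])
  refine h.eq_zero_of_im_ne_zero fun z hz => ?_
  rcases lt_or_gt_of_ne hz with hz | hz
  · have hz' : conj z ∈ upperHalf := by simpa [upperHalf] using hz
    obtain ⟨-, -, h1, h2⟩ := key _ hz'
    rw [Complex.conj_conj, map_eq_zero] at h1 h2
    ext i
    fin_cases i
    · exact h1
    · exact h2
  · obtain ⟨h1, h2, -, -⟩ := key z hz
    ext i
    fin_cases i
    · exact h1
    · exact h2

lemma smul_sub_smul (h : IsPreSolution c d v m) (h' : IsPreSolution c d v m') (s s' : ℂ) :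
    IsPreSolution c d v (fun p => s • m p - s' • m' p) where
  holomorphic σ :=
    ⟨((h.holomorphic σ).1.const_smul s).sub ((h'.holomorphic σ).1.const_smul s'),
      ((h.holomorphic σ).2.const_smul s).sub ((h'.holomorphic σ).2.const_smul s')⟩
  jump x hx σ := by
    obtain ⟨p, q, h1, h2, h3⟩ := h.jump x hx σ
    obtain ⟨p', q', h1', h2', h3'⟩ := h'.jump x hx σ
    refine ⟨s • p - s' • p', s • q - s' • q', (h1.const_smul s).sub (h1'.const_smul s'),
      (h2.const_smul s).sub (h2'.const_smul s'), ?_⟩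
    rw [Matrix.sub_vecMul, Matrix.smul_vecMul, Matrix.smul_vecMul, h3, h3']
  symmetry p hp := by
    rw [h.symmetry p hp, h'.symmetry p hp, Matrix.sub_vecMul, Matrix.smul_vecMul,
      Matrix.smul_vecMul]

end IsPreSolution

/-- If the vanishing problem has only the trivial solution, then solutions are unique. -/
theorem eqOn_of_vanishing {c d : ℝ} {v : ℝ → Side → Matrix (Fin 2) (Fin 2) ℂ}
    (hv : ∀ m, IsVanishingSolution c d v m → ∀ p ∈ offContour c d, m p = 0)
    {m m' : SurfPt → Fin 2 → ℂ} (h : IsSolution c d v m) (h' : IsSolution c d v m') :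
    Set.EqOn m m' (offContour c d) := by
  obtain ⟨s, t, hl, hst, hs⟩ := h.normalization
  obtain ⟨s', t', hl', hst', hs'⟩ := h'.normalization
  have hm := tendsto_nhds_unique h.toIsPreSolution.tendsto_infty hl
  have hm' := tendsto_nhds_unique h'.toIsPreSolution.tendsto_infty hl'
  -- The weights cancel the first components at ∞₊. The second components, 1/s and 1/s', then force
  -- s² = s'², and positivity gives s = s'.
  have hz := hv (fun p => (s' : ℂ) • m p - (s : ℂ) • m' p)
    ⟨h.toIsPreSolution.smul_sub_smul h'.toIsPreSolution s' s, by simp [hm, hm', mul_comm]⟩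
  have hss : s = s' := by
    have h1 := congrFun (hz _ (infty_mem_offContour (s := .upper))) 1
    simp only [hm, hm', Pi.sub_apply, Pi.smul_apply, Matrix.cons_val_one, Matrix.cons_val_fin_one,
      smul_eq_mul, Pi.zero_apply] at h1
    have h2 : (s : ℂ) ^ 2 = (s' : ℂ) ^ 2 := by
      linear_combination s * s' * (-h1) + s' ^ 2 * hst - s ^ 2 * hst'
    have h3 : s ^ 2 = s' ^ 2 := by exact_mod_cast h2
    exact (pow_left_inj₀ hs.le hs'.le two_ne_zero).1 h3
  intro p hp
  have h1 := hz p hp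
  rw [hss, ← smul_sub, smul_eq_zero, or_iff_right (by exact_mod_cast hs'.ne')] at h1
  exact sub_eq_zero.1 h1

/-! ### The Joukovski variable on the real line -/

section Joukovski

variable {α β : ℝ}

lemma rootAt_sq (α β x : ℝ) (σ : Side) : rootAt α β x σ ^ 2 = ((x : ℂ) - β) ^ 2 - 4 * α ^ 2 := by
  cases σ
  · exact cutRoot_sq α β x
  · simp only [rootAt]
    rw [← map_pow, cutRoot_sq]
    simp [Complex.conj_ofNat]

lemma zAt_mul (hα : 0 < α) (x : ℝ) (σ : Side) :
    zAt α β x σ * (((x : ℂ) - β + rootAt α β x σ) / (2 * α)) = 1 := by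
  have hα' : (α : ℂ) ≠ 0 := by exact_mod_cast hα.ne'
  rw [zAt]
  field_simp
  linear_combination -rootAt_sq α β x σ

lemma zAt_ne_zero (hα : 0 < α) (x : ℝ) (σ : Side) : zAt α β x σ ≠ 0 :=
  left_ne_zero_of_mul_eq_one (zAt_mul hα x σ)

lemma zAt_inv (hα : 0 < α) (x : ℝ) (σ : Side) :
    (zAt α β x σ)⁻¹ = ((x : ℂ) - β + rootAt α β x σ) / (2 * α) :=
  inv_eq_of_mul_eq_one_right (zAt_mul hα x σ)

lemma zAt_add_inv (hα : 0 < α) (x : ℝ) (σ : Side) :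
    (x : ℂ) = β + α * (zAt α β x σ + (zAt α β x σ)⁻¹) := by
  have hα' : (α : ℂ) ≠ 0 := by exact_mod_cast hα.ne'
  rw [zAt_inv hα, zAt]
  field_simp
  ring

lemma zAt_inv_sub (hα : 0 < α) (x : ℝ) (σ : Side) :
    α * ((zAt α β x σ)⁻¹ - zAt α β x σ) = rootAt α β x σ := by
  have hα' : (α : ℂ) ≠ 0 := by exact_mod_cast hα.ne'
  rw [zAt_inv hα, zAt]
  field_simp
  ring

lemma zAt_sq_ne_one (hα : 0 < α) {x : ℝ} {σ : Side} (h : rootAt α β x σ ≠ 0) :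
    zAt α β x σ ^ 2 ≠ 1 := by
  intro h1
  have h2 : (zAt α β x σ)⁻¹ = zAt α β x σ := inv_eq_of_mul_eq_one_right (by rwa [← pow_two])
  apply h
  rw [← zAt_inv_sub hα, h2, sub_self, mul_zero]

/-- The root is imaginary on the band, so conjugation exchanges z and z⁻¹. -/
lemma norm_zAt_eq_one (hα : 0 < α) {x : ℝ} (hx : x ∈ Set.Ioo (β - 2 * α) (β + 2 * α))
    (σ : Side) : ‖zAt α β x σ‖ = 1 := by
  obtain ⟨s, -, hs⟩ := exists_cutRoot_eq_of_mem_Ioo hx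
  have hconj : conj (zAt α β x σ) = (zAt α β x σ)⁻¹ := by
    rw [zAt_inv hα, zAt]
    cases σ <;> simp [rootAt, hs, sub_eq_add_neg, Complex.conj_ofNat]
  have h1 : zAt α β x σ * conj (zAt α β x σ) = 1 := by
    rw [hconj, mul_inv_cancel₀ (zAt_ne_zero hα x σ)]
  rw [Complex.mul_conj'] at h1
  have h2 : ‖zAt α β x σ‖ ^ 2 = 1 := by exact_mod_cast h1
  exact (pow_eq_one_iff_of_nonneg (norm_nonneg _) two_ne_zero).1 h2

/-- Off the band the root is real with the sign of x - β, so (x - β + s)/(2α), which is z⁻¹, has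
modulus greater than 1. -/
lemma exists_zAt_eq_of_notMem (hα : 0 < α) {x : ℝ}
    (hx : x ∉ Set.Icc (β - 2 * α) (β + 2 * α)) :
    ∃ u : ℝ, u ≠ 0 ∧ |u| < 1 ∧ ∀ σ, zAt α β x σ = u := by
  obtain ⟨s, hs, hsx⟩ : ∃ s : ℝ, 2 * α < |x - β + s| ∧ cutRoot α β x = s := by
    rw [Set.mem_Icc, not_and_or, not_le, not_le] at hx
    rcases hx with hx | hx
    · refine ⟨_, ?_, cutRoot_of_lt hα hx⟩
      have : 0 ≤ √(β + 2 * α - x) * √(β - 2 * α - x) := by positivity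
      rw [lt_abs]
      right
      linarith
    · refine ⟨_, ?_, cutRoot_of_gt hα hx⟩
      have : 0 ≤ √(x - β - 2 * α) * √(x - β + 2 * α) := by positivity
      rw [lt_abs]
      left
      linarith
  have hroot : ∀ σ, rootAt α β x σ = s := by
    intro σ
    cases σ <;> simp [rootAt, hsx]
  have hz : ∀ σ, zAt α β x σ = ((x - β - s) / (2 * α) : ℝ) := by
    intro σ
    rw [zAt, hroot]
    push_cast
    ring
  refine ⟨_, ?_, ?_, hz⟩
  · have := zAt_ne_zero (β := β) hα x .up
    rw [hz] at this
    exact_mod_cast this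
  · have h1 := zAt_mul (β := β) hα x .up
    rw [hz, hroot] at h1
    have h2 : (x - β - s) / (2 * α) * ((x - β + s) / (2 * α)) = 1 := by exact_mod_cast h1
    have h3 : |(x - β - s) / (2 * α)| * |(x - β + s) / (2 * α)| = 1 := by
      rw [← abs_mul, h2, abs_one]
    have h4 : 1 < |(x - β + s) / (2 * α)| := by
      rw [abs_div, abs_of_pos (by linarith : 0 < 2 * α), one_lt_div (by linarith)]
      exact hs
    by_contra! h5
    nlinarith

end Joukovski

/-! ### Left Jost solutions by reflection -/

lemma exists_left_jost {a b : ℤ → ℝ} (ha : ∀ n, 0 < a n) {α β : ℝ} (hα : α ≠ 0)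
    (hsa : Summable fun n : ℕ => |a (-(n : ℤ) - 1) - α|)
    (hsb : Summable fun n : ℕ => |b (-(n : ℤ)) - β|)
    {E z : ℂ} (hz0 : z ≠ 0) (hz : ‖z‖ ≤ 1) (hz2 : z ^ 2 ≠ 1) (hE : E = β + α * (z + z⁻¹)) :
    ∃ ψ, IsJacobiSolution a b E ψ ∧ Tendsto (fun n : ℤ => z ^ n * ψ n) atBot (𝓝 1) := by
  obtain ⟨ψ, h1, h2⟩ := exists_jost (a := fun n => a (-n - 1)) (b := fun n => b (-n))
    (fun n => ha _) hα hsa hsb hz0 hz hz2 hE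
  refine ⟨fun n => ψ (-n), by simpa using h1.reflect, ?_⟩
  simpa [Function.comp_def] using h2.comp tendsto_neg_atBot_atTop

lemma reflect_tendsto {z : ℂ} {ψ : ℤ → ℂ} (hl : Tendsto (fun n : ℤ => z ^ n * ψ n) atBot (𝓝 1)) :
    Tendsto (fun n : ℤ => z ^ (-n) * ψ (-n)) atTop (𝓝 1) :=
  hl.comp tendsto_neg_atTop_atBot

lemma left_wronskian_conj_of_norm_eq_one {a b : ℤ → ℝ} {α x : ℝ}
    (hsa : Summable fun n : ℕ => |a (-(n : ℤ) - 1) - α|) {z : ℂ} (hz : ‖z‖ = 1) {ψ : ℤ → ℂ}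
    (hψ : IsJacobiSolution a b x ψ) (hl : Tendsto (fun n : ℤ => z ^ n * ψ n) atBot (𝓝 1))
    (n : ℤ) : wronskian a ψ (fun k => conj (ψ k)) n = -(α * (z⁻¹ - z)) := by
  have h := wronskian_conj_of_norm_eq_one (a := fun k => a (-k - 1)) hsa hz hψ.reflect
    (reflect_tendsto hl) (1 - n)
  have h' := wronskian_reflect a ψ (fun k => conj (ψ k)) (1 - n)
  rw [sub_sub_cancel] at h'
  rw [← h, h', neg_neg]

lemma left_wronskian_conj_of_norm_lt_one {a b : ℤ → ℝ} {α x : ℝ}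
    (hsa : Summable fun n : ℕ => |a (-(n : ℤ) - 1) - α|) {z : ℂ} (hz0 : z ≠ 0) (hz : ‖z‖ < 1)
    {ψ : ℤ → ℂ} (hψ : IsJacobiSolution a b x ψ)
    (hl : Tendsto (fun n : ℤ => z ^ n * ψ n) atBot (𝓝 1))
    (n : ℤ) : wronskian a ψ (fun k => conj (ψ k)) n = 0 := by
  have h := wronskian_conj_of_norm_lt_one (a := fun k => a (-k - 1)) hsa hz0 hz hψ.reflect
    (reflect_tendsto hl) (1 - n)
  have h' := wronskian_reflect a ψ (fun k => conj (ψ k)) (1 - n)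
  rw [sub_sub_cancel] at h'
  rw [← neg_eq_zero, ← h', h]

/-! ### Scattering data on the two bands -/

namespace IsShockData

variable {c d : ℝ} {a b : ℤ → ℝ}

/-- The exponential weights are at least 1, which leaves plain summability. The left off-diagonal
coefficients appear shifted by one, as reflection requires. -/
lemma exists_summable (h : IsShockData c d a b) :
    (Summable fun n : ℕ => |a (-(n : ℤ) - 1) - d|) ∧ (Summable fun n : ℕ => |b (-(n : ℤ)) - -c|) ∧
      (Summable fun n : ℕ => |a n - (1 / 2 : ℝ)|) ∧ Summable fun n : ℕ => |b n - 0| := by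
  obtain ⟨C, hC, h1, h2⟩ := h.decay
  have hC0 : 0 ≤ C := by
    refine le_trans ?_ ((le_max_left _ _).trans hC)
    have := h.one_lt
    have := h.d_pos
    positivity
  have hone : ∀ (n : ℕ) (s t : ℝ), 0 ≤ s → 0 ≤ t → s ≤ Real.exp (C * n) * (s + t) ∧
      t ≤ Real.exp (C * n) * (s + t) := by
    intro n s t hs ht
    have he : 1 ≤ Real.exp (C * n) := Real.one_le_exp (by positivity)
    constructor <;> nlinarith
  have ha : Summable fun n : ℕ => |a (-(n : ℤ)) - d| :=
    Summable.of_nonneg_of_le (fun _ => abs_nonneg _)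
      (fun n => (hone n _ _ (abs_nonneg _) (abs_nonneg _)).1) h1
  refine ⟨?_, ?_, ?_, ?_⟩
  · refine ((summable_nat_add_iff 1).2 ha).congr fun n => ?_
    rw [show -((n + 1 : ℕ) : ℤ) = -(n : ℤ) - 1 by push_cast; ring]
  · simp only [sub_neg_eq_add]
    exact Summable.of_nonneg_of_le (fun _ => abs_nonneg _)
      (fun n => (hone n _ _ (abs_nonneg _) (abs_nonneg _)).2) h1
  · exact Summable.of_nonneg_of_le (fun _ => abs_nonneg _)
      (fun n => (hone n _ _ (abs_nonneg _) (abs_nonneg _)).1) h2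
  · simp only [sub_zero]
    exact Summable.of_nonneg_of_le (fun _ => abs_nonneg _)
      (fun n => (hone n _ _ (abs_nonneg _) (abs_nonneg _)).2) h2

/-- `ψ₁` is a choice, so existence of a Jost solution is what gives it its properties; uniqueness is
not needed. -/
lemma isLeftJost_ψ₁ (h : IsShockData c d a b) {x : ℝ} (hx : ‖z₁ c d x .up‖ ≤ 1)
    (hr : rootAt d (-c) x .up ≠ 0) : IsLeftJost c d a b x .up (ψ₁ c d a b x .up) := by
  obtain ⟨h1, h2, -, -⟩ := h.exists_summable
  exact Classical.epsilon_spec (p := IsLeftJost c d a b x .up)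
    (exists_left_jost h.a_pos h.d_pos.ne' h1 h2 (zAt_ne_zero h.d_pos x .up) hx
      (zAt_sq_ne_one h.d_pos hr) (zAt_add_inv h.d_pos x .up))

lemma isRightJost_ψ₂ (h : IsShockData c d a b) {x : ℝ} (hx : ‖z₂ x .up‖ ≤ 1)
    (hr : rootAt (1 / 2) 0 x .up ≠ 0) : IsRightJost a b x .up (ψ₂ a b x .up) := by
  obtain ⟨-, -, h1, h2⟩ := h.exists_summable
  have half : (0 : ℝ) < 1 / 2 := by norm_num
  exact Classical.epsilon_spec (p := IsRightJost a b x .up)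
    (exists_jost h.a_pos half.ne' h1 h2 (zAt_ne_zero half x .up) hx
      (zAt_sq_ne_one half hr) (zAt_add_inv half x .up))

lemma W_eq_wronskian (c d : ℝ) (a b : ℤ → ℝ) (x : ℝ) (σ : Side) :
    W c d a b x σ = wronskian a (ψ₁ c d a b x σ) (ψ₂ a b x σ) 1 := by
  simp [W, wronskian]

lemma notMem_band_right (h : IsShockData c d a b) {x : ℝ}
    (hx : x ∈ Set.Icc (-c - 2 * d) (-c + 2 * d)) :
    x ∉ Set.Icc ((0 : ℝ) - 2 * (1 / 2)) (0 + 2 * (1 / 2)) := by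
  intro hx'
  have := h.separated
  linarith [hx.2, hx'.1]

lemma notMem_band_left (h : IsShockData c d a b) {x : ℝ} (hx : x ∈ Set.Icc (-1 : ℝ) 1) :
    x ∉ Set.Icc (-c - 2 * d) (-c + 2 * d) := by
  intro hx'
  have := h.separated
  linarith [hx.1, hx'.2]

/-- The Wronskian of the Jost solutions does not vanish inside the left band, and the left
reflection coefficient is unimodular. -/
lemma W_ne_zero_and_norm_R₁ (h : IsShockData c d a b) {x : ℝ}
    (hx : x ∈ Set.Ioo (-c - 2 * d) (-c + 2 * d)) :
    W c d a b x .up ≠ 0 ∧ ‖R₁ c d a b x .up‖ = 1 := by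
  have half : (0 : ℝ) < 1 / 2 := by norm_num
  obtain ⟨hs1, -, hs2, -⟩ := h.exists_summable
  have hn : ‖z₁ c d x .up‖ = 1 := norm_zAt_eq_one h.d_pos hx .up
  have hr1 : rootAt d (-c) x .up ≠ 0 := by
    obtain ⟨s, hs, hR⟩ := exists_cutRoot_eq_of_mem_Ioo hx
    rw [rootAt, hR]
    exact mul_ne_zero Complex.I_ne_zero (by exact_mod_cast hs.ne')
  have hoff := h.notMem_band_right (Set.Ioo_subset_Icc_self hx)
  have hr2 : rootAt (1 / 2) 0 x .up ≠ 0 := by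
    obtain ⟨s, hs, hR⟩ := exists_cutRoot_eq_of_notMem half hoff
    rw [rootAt, hR]
    exact_mod_cast hs
  have hlt : ‖z₂ x .up‖ < 1 := by
    obtain ⟨u, -, hu, hz⟩ := exists_zAt_eq_of_notMem half hoff
    rw [z₂, hz, Complex.norm_real]
    exact hu
  obtain ⟨j1, l1⟩ := h.isLeftJost_ψ₁ hn.le hr1
  obtain ⟨j2, l2⟩ := h.isRightJost_ψ₂ hlt.le hr2
  have hw : ∀ n, wronskian a (ψ₁ c d a b x .up) (fun k => conj (ψ₁ c d a b x .up k)) n =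
      -rootAt d (-c) x .up := fun n => by
    rw [left_wronskian_conj_of_norm_eq_one hs1 hn j1 l1 n]
    exact congrArg Neg.neg (zAt_inv_sub h.d_pos x .up)
  have hw0 := wronskian_conj_of_norm_lt_one hs2 (zAt_ne_zero half x .up) hlt j2 l2
  obtain ⟨hW, r, hr, hrel⟩ := scattering_relation (neg_ne_zero.2 hr1) j1 j2 hw hw0
    (exists_ne_zero_of_jost l2)
  rw [← W_eq_wronskian] at hW hrel
  refine ⟨hW, ?_⟩
  -- The chosen `R₁` satisfies the same relation as r, and they agree because ψ₁ is nonzero at some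
  -- site.
  have hR := Classical.epsilon_spec (p := fun r : ℂ => ∀ n : ℤ,
    T₁ c d a b x .up * ψ₂ a b x .up n =
      conj (ψ₁ c d a b x .up n) + r * ψ₁ c d a b x .up n) ⟨r, hrel⟩
  obtain ⟨n, hn0⟩ := exists_ne_zero_of_jost (reflect_tendsto l1)
  have heq : R₁ c d a b x .up = r := by
    refine mul_right_cancel₀ hn0 ?_
    have e1 := hR (-n)
    have e2 := hrel (-n)
    simp only [T₁] at e1
    exact add_left_cancel (e1.symm.trans e2)
  rw [heq, hr]

/-- The Wronskian of the Jost solutions does not vanish inside the right band, and the right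
reflection coefficient is unimodular. -/
lemma W_ne_zero_and_norm_R₂ (h : IsShockData c d a b) {x : ℝ} (hx : x ∈ Set.Ioo (-1 : ℝ) 1) :
    W c d a b x .up ≠ 0 ∧ ‖R₂ c d a b x .up‖ = 1 := by
  have half : (0 : ℝ) < 1 / 2 := by norm_num
  have hx' : x ∈ Set.Ioo ((0 : ℝ) - 2 * (1 / 2)) (0 + 2 * (1 / 2)) := by
    constructor <;> linarith [hx.1, hx.2]
  obtain ⟨hs1, -, hs2, -⟩ := h.exists_summable
  have hn : ‖z₂ x .up‖ = 1 := norm_zAt_eq_one half hx' .up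
  have hr2 : rootAt (1 / 2) 0 x .up ≠ 0 := by
    obtain ⟨s, hs, hR⟩ := exists_cutRoot_eq_of_mem_Ioo hx'
    rw [rootAt, hR]
    exact mul_ne_zero Complex.I_ne_zero (by exact_mod_cast hs.ne')
  have hoff := h.notMem_band_left (Set.Ioo_subset_Icc_self hx)
  have hr1 : rootAt d (-c) x .up ≠ 0 := by
    obtain ⟨s, hs, hR⟩ := exists_cutRoot_eq_of_notMem h.d_pos hoff
    rw [rootAt, hR]
    exact_mod_cast hs
  have hlt : ‖z₁ c d x .up‖ < 1 := by
    obtain ⟨u, -, hu, hz⟩ := exists_zAt_eq_of_notMem h.d_pos hoff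
    rw [z₁, hz, Complex.norm_real]
    exact hu
  obtain ⟨j1, l1⟩ := h.isLeftJost_ψ₁ hlt.le hr1
  obtain ⟨j2, l2⟩ := h.isRightJost_ψ₂ hn.le hr2
  have hw : ∀ n, wronskian a (ψ₂ a b x .up) (fun k => conj (ψ₂ a b x .up k)) n =
      rootAt (1 / 2) 0 x .up := fun n => by
    rw [wronskian_conj_of_norm_eq_one hs2 hn j2 l2 n]
    exact zAt_inv_sub half x .up
  have hw0 := left_wronskian_conj_of_norm_lt_one hs1 (zAt_ne_zero h.d_pos x .up) hlt j1 l1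
  obtain ⟨k, hk⟩ := exists_ne_zero_of_jost (reflect_tendsto l1)
  obtain ⟨hW, r, hr, hrel⟩ := scattering_relation hr2 j2 j1 hw hw0 ⟨-k, hk⟩
  have hWneg : wronskian a (ψ₂ a b x .up) (ψ₁ c d a b x .up) 1 = -W c d a b x .up := by
    simp only [W, wronskian, sub_self]
    ring
  rw [hWneg] at hW hrel
  refine ⟨neg_ne_zero.1 hW, ?_⟩
  have hrel' : ∀ n, T₂ c d a b x .up * ψ₁ c d a b x .up n =
      conj (ψ₂ a b x .up n) + r * ψ₂ a b x .up n := fun n => by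
    rw [← hrel n, T₂, neg_div, div_neg]
  have hR := Classical.epsilon_spec (p := fun r : ℂ => ∀ n : ℤ,
    T₂ c d a b x .up * ψ₁ c d a b x .up n =
      conj (ψ₂ a b x .up n) + r * ψ₂ a b x .up n) ⟨r, hrel'⟩
  obtain ⟨n, hn0⟩ := exists_ne_zero_of_jost l2
  have heq : R₂ c d a b x .up = r := by
    refine mul_right_cancel₀ hn0 ?_
    exact add_left_cancel ((hR n).symm.trans (hrel' n))
  rw [heq, hr]

end IsShockData

/-! ### The form of the jump matrices -/

/-- An imaginary phase contributes a unimodular factor, which is absorbed into ρ. -/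
lemma ownJump_eq {t : ℝ} {R Φ : ℂ} (hR : ‖R‖ = 1) (hΦ : Φ.re = 0) :
    ∃ ρ : ℂ, ‖ρ‖ = 1 ∧ ownJump t R Φ = !![0, -conj ρ; ρ, 1] := by
  refine ⟨R * Complex.exp (2 * t * Φ), ?_, ?_⟩
  · rw [norm_mul, hR, Complex.norm_exp, one_mul]
    simp [hΦ]
  · have hc : conj Φ = -Φ := by
      apply Complex.ext <;> simp [hΦ]
    rw [ownJump, map_mul, ← Complex.exp_conj, map_mul, map_mul, hc]
    simp [Complex.conj_ofNat]

/-- Here Φ is the value at x - i0, so Φ₊ = conj Φ and Φ₋ = -Φ. Their sum times t lies in 2πiℤ, while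
their difference is 2 Re Φ. -/
lemma crossJump_eq {t : ℝ} {X Φ : ℂ} {k : ℤ} (hk : t * Φ.im = k * Real.pi) :
    crossJump t X (conj Φ) (-Φ) = !![X * Real.exp (2 * t * Φ.re), 1; 1, 0] := by
  have h1 : (t : ℂ) * (conj Φ - -Φ) = ((2 * t * Φ.re : ℝ) : ℂ) := by
    apply Complex.ext <;> simp
    ring
  have h2 : (t : ℂ) * (conj Φ + -Φ) = ((-k : ℤ) : ℂ) * (2 * Real.pi * Complex.I) := by
    apply Complex.ext
    · simp
    · simp
      linear_combination (-2) * hk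
  have h3 : -((t : ℂ) * (conj Φ + -Φ)) = (k : ℂ) * (2 * Real.pi * Complex.I) := by
    rw [h2]
    push_cast
    ring
  rw [crossJump, h1, h3, h2, Complex.exp_int_mul_two_pi_mul_I, Complex.exp_int_mul_two_pi_mul_I,
    Complex.ofReal_exp]

lemma inv_sub_re_of_norm_eq_one {z : ℂ} (hz : ‖z‖ = 1) : (z⁻¹ - z).re = 0 := by
  rw [Complex.inv_eq_conj hz]
  simp

lemma log_re_of_norm_eq_one {z : ℂ} (hz : ‖z‖ = 1) : (Complex.log z).re = 0 := by
  rw [Complex.log_re, hz, Real.log_one]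

lemma exists_log_im_ofReal (u : ℝ) : ∃ k : ℤ, (Complex.log u).im = k * Real.pi := by
  rw [Complex.log_im]
  rcases le_or_gt 0 u with hu | hu
  · exact ⟨0, by rw [Complex.arg_ofReal_of_nonneg hu]; simp⟩
  · exact ⟨1, by rw [Complex.arg_ofReal_of_neg hu]; simp⟩

lemma Φ₁_up (c d ξ x : ℝ) : Φ₁ c d ξ x .up = conj (Φ₁ c d ξ x .down) := rfl

lemma Φ₂_up (ξ x : ℝ) : Φ₂ ξ x .up = conj (Φ₂ ξ x .down) := rfl

lemma Φ₁_re_eq_zero {c d x : ℝ} (hd : 0 < d) (hx : x ∈ Set.Ioo (-c - 2 * d) (-c + 2 * d))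
    (ξ : ℝ) : (Φ₁ c d ξ x .up).re = 0 := by
  have hn : ‖z₁ c d x .down‖ = 1 := norm_zAt_eq_one hd hx .down
  rw [Φ₁_up, Complex.conj_re, Φ₁, Complex.sub_re, Complex.re_ofReal_mul, Complex.re_ofReal_mul,
    inv_sub_re_of_norm_eq_one hn, log_re_of_norm_eq_one hn]
  simp

lemma Φ₂_re_eq_zero {x : ℝ} (hx : x ∈ Set.Ioo (-1 : ℝ) 1) (ξ : ℝ) : (Φ₂ ξ x .up).re = 0 := by
  have hn : ‖z₂ x .down‖ = 1 := norm_zAt_eq_one (by norm_num)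
    (by constructor <;> linarith [hx.1, hx.2]) .down
  rw [Φ₂_up, Complex.conj_re, Φ₂, Complex.add_re, Complex.re_ofReal_mul,
    log_re_of_norm_eq_one hn, ← neg_sub, neg_div, Complex.neg_re, Complex.div_ofNat_re,
    inv_sub_re_of_norm_eq_one hn]
  simp

/-- Off the band z₁ is real and its logarithm has imaginary part 0 or π. The product tξ is the
integer n, which keeps the result in πℤ. -/
lemma exists_Φ₁_im {c d x : ℝ} (hd : 0 < d) (hx : x ∉ Set.Icc (-c - 2 * d) (-c + 2 * d))
    (n : ℤ) {t : ℝ} (ht : 0 < t) : ∃ k : ℤ, t * (Φ₁ c d (n / t) x .down).im = k * Real.pi := by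
  obtain ⟨u, -, -, hu⟩ := exists_zAt_eq_of_notMem hd hx
  obtain ⟨k, hk⟩ := exists_log_im_ofReal u
  refine ⟨-(n * k), ?_⟩
  rw [Φ₁, z₁, hu, Complex.sub_im, Complex.im_ofReal_mul, Complex.im_ofReal_mul, hk,
    ← Complex.ofReal_inv, ← Complex.ofReal_sub, Complex.ofReal_im]
  push_cast
  field_simp
  ring

lemma exists_Φ₂_im {x : ℝ} (hx : x ∉ Set.Icc ((0 : ℝ) - 2 * (1 / 2)) (0 + 2 * (1 / 2)))
    (n : ℤ) {t : ℝ} (ht : 0 < t) : ∃ k : ℤ, t * (Φ₂ (n / t) x .down).im = k * Real.pi := by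
  obtain ⟨u, -, -, hu⟩ := exists_zAt_eq_of_notMem (by norm_num) hx
  obtain ⟨k, hk⟩ := exists_log_im_ofReal u
  refine ⟨n * k, ?_⟩
  rw [Φ₂, z₂, hu, Complex.add_im, Complex.im_ofReal_mul, hk, Complex.div_ofNat_im,
    ← Complex.ofReal_inv, ← Complex.ofReal_sub, Complex.ofReal_im]
  push_cast
  field_simp
  ring

/-- The two Wronskians combine to |W|², so the phase of χ comes from the background roots alone. -/
lemma χ_eq (c d : ℝ) (a b : ℤ → ℝ) (x : ℝ) (σ : Side) :
    χ c d a b x σ =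
      -(rootAt d (-c) x σ * conj (rootAt (1 / 2) 0 x σ)) / (‖W c d a b x σ‖ ^ 2 : ℝ) := by
  rw [χ, T₁, T₂]
  push_cast
  rw [← Complex.mul_conj', map_div₀, map_neg, div_mul_div_comm]
  ring

namespace IsShockData

variable {c d : ℝ} {a b : ℤ → ℝ}

/-- The vanishing problem for the left jump matrix. -/
theorem left_vanishing (h : IsShockData c d a b) (n : ℤ) {t : ℝ} (ht : 0 < t)
    (m : SurfPt → Fin 2 → ℂ) (hm : IsVanishingSolution c d (v₁ c d a b n t) m) :
    ∀ p ∈ offContour c d, m p = 0 := by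
  refine hm.toIsPreSolution.eq_zero_of_jump_form (α := d) (β := -c) (p := -1) (q := 1) h.d_pos
    (by norm_num) (fun x hx => h.notMem_band_left hx) rfl (fun x hx => ?_) (fun x hx => ?_)
    hm.vanishing
  · rw [v₁, if_pos (show x ∈ bandOne c d from Set.Ioo_subset_Icc_self hx)]
    exact ownJump_eq (h.W_ne_zero_and_norm_R₁ hx).2 (Φ₁_re_eq_zero h.d_pos hx _)
  · have hoff := h.notMem_band_left (Set.Ioo_subset_Icc_self hx)
    obtain ⟨k, hk⟩ := exists_Φ₁_im h.d_pos hoff n ht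
    obtain ⟨s₂, hs₂, hR₂⟩ := exists_cutRoot_eq_of_mem_Ioo (α := 1 / 2) (β := 0) (x := x)
      (by constructor <;> linarith [hx.1, hx.2])
    obtain ⟨s₁, -, hR₁⟩ := exists_cutRoot_eq_of_notMem h.d_pos hoff
    have hW : 0 < ‖W c d a b x .up‖ := norm_pos_iff.2 (h.W_ne_zero_and_norm_R₂ hx).1
    -- On the right band the roots are s₁ (left, real) and i s₂ (right), so conj χ = -i s₁ s₂/|W|².
    -- Factoring out -i s₁ leaves this positive κ.
    refine ⟨s₂ / ‖W c d a b x .up‖ ^ 2 * Real.exp (2 * t * (Φ₁ c d (n / t) x .down).re),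
      by positivity, ?_⟩
    rw [v₁, if_neg (show x ∉ bandOne c d from hoff), Φ₁_up, Φ₁Minus, Side.flip, crossJump_eq hk, χ_eq]
    congr 3
    simp only [rootAt, hR₁, hR₂]
    simp
    ring

/-- The vanishing problem for the right jump matrix. -/
theorem right_vanishing (h : IsShockData c d a b) (n : ℤ) {t : ℝ} (ht : 0 < t)
    (m : SurfPt → Fin 2 → ℂ) (hm : IsVanishingSolution c d (v₂ c d a b n t) m) :
    ∀ p ∈ offContour c d, m p = 0 := by
  have hd := h.d_pos
  have hband : Set.Icc ((0 : ℝ) - 2 * (1 / 2)) (0 + 2 * (1 / 2)) = bandTwo := by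
    norm_num [bandTwo]
  have hmem : ∀ {x : ℝ}, x ∈ Set.Ioo ((0 : ℝ) - 2 * (1 / 2)) (0 + 2 * (1 / 2)) →
      x ∈ Set.Ioo (-1 : ℝ) 1 := fun hx => by constructor <;> linarith [hx.1, hx.2]
  refine hm.toIsPreSolution.eq_zero_of_jump_form (α := 1 / 2) (β := 0) (p := -c - 2 * d)
    (q := -c + 2 * d) (by norm_num) (by linarith) (fun x hx => h.notMem_band_right hx)
    (by rw [hband, bandOne, Set.union_comm]) (fun x hx => ?_) (fun x hx => ?_) hm.vanishing
  · rw [v₂, if_pos (show x ∈ bandTwo from Set.Ioo_subset_Icc_self (hmem hx))]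
    exact ownJump_eq (h.W_ne_zero_and_norm_R₂ (hmem hx)).2 (Φ₂_re_eq_zero (hmem hx) _)
  · have hoff := h.notMem_band_right (Set.Ioo_subset_Icc_self hx)
    obtain ⟨k, hk⟩ := exists_Φ₂_im hoff n ht
    obtain ⟨s₁, hs₁, hR₁⟩ := exists_cutRoot_eq_of_mem_Ioo hx
    obtain ⟨s₂, -, hR₂⟩ := exists_cutRoot_eq_of_notMem (by norm_num) hoff
    have hW : 0 < ‖W c d a b x .up‖ := norm_pos_iff.2 (h.W_ne_zero_and_norm_R₁ hx).1
    -- On the left band the roles are exchanged: χ itself equals -i s₁ s₂/|W|², with s₂ the real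
    -- root.
    refine ⟨s₁ / ‖W c d a b x .up‖ ^ 2 * Real.exp (2 * t * (Φ₂ (n / t) x .down).re),
      by positivity, ?_⟩
    rw [hband] at hoff
    rw [v₂, if_neg hoff, Φ₂_up, Φ₂Minus, Side.flip, crossJump_eq hk, χ_eq]
    congr 3
    simp only [rootAt, hR₁, hR₂]
    simp
    ring

end IsShockData

end TodaShock

end

theorem mainTheorem6 (c d : ℝ) (a b : ℤ → ℝ) (h : TodaShock.IsShockData c d a b)
    (n : ℤ) (t : ℝ) (ht : 0 < t) :
    ∀ v ∈ ({TodaShock.v₁ c d a b n t, TodaShock.v₂ c d a b n t} :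
        Set (ℝ → TodaShock.Side → Matrix (Fin 2) (Fin 2) ℂ)),
      (∀ m m' : TodaShock.SurfPt → Fin 2 → ℂ,
        TodaShock.IsSolution c d v m → TodaShock.IsSolution c d v m' →
          Set.EqOn m m' (TodaShock.offContour c d)) ∧
      (∀ m : TodaShock.SurfPt → Fin 2 → ℂ,
        TodaShock.IsVanishingSolution c d v m → ∀ p ∈ TodaShock.offContour c d, m p = 0) := by
  intro v hv
  have key : ∀ m : TodaShock.SurfPt → Fin 2 → ℂ,
      TodaShock.IsVanishingSolution c d v m → ∀ p ∈ TodaShock.offContour c d, m p = 0 := by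
    rcases hv with rfl | rfl
    · exact h.left_vanishing n ht
    · exact h.right_vanishing n ht
  exact ⟨fun m m' hm hm' => TodaShock.eqOn_of_vanishing key hm hm', key⟩
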